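/- **Model.** Let $n$ be even and let $\sigma:[n]\to\{1,2\}$ take each value exactly $n/2$ times. Let $X_1,\dots,X_n$ be independent and uniform on $[0,1]$, and $d_{uv}=\min(|X_u-X_v|,\,1-|X_u-X_v|)$. In the random graph $GBM(n,\sigma,\theta_1,\theta_2)$ on $[n]$, distinct nodes $u,v$ are adjacent iff $d_{uv}\le\theta_1\frac{\log n}{n}$ when $\sigma(u)=\sigma(v)$, and iff $d_{uv}\le\theta_2\frac{\log n}{n}$ when $\sigma(u)\ne\sigma(v)$. **Algorithm** (input: a graph $G$ on $[n]$, a threshold $E_T$, and an oracle that reveals the label $\sigma(x)$ of a queried node $x$). *Phase 1.* Delete from $G$ every edge $(u,v)$ for which the number of $z$ adjacent in $G$ to both $u$ and $v$ is at most $nE_T$. Call the result $G_r$. *Phase 2 (the $S^2$ algorithm).* Starting with the graph $G_r$ and no labels known, stop as soon as the current graph has (at least) two connected components. Otherwise, if the current graph has a path between two queried nodes with different labels, take a shortest one among all such paths and query its midpoint (ties are broken arbitrarily, and for odd length either middle node may be taken); if there is no such path, query a node chosen uniformly at random among those not yet queried, independently of everything else. After each query delete all edges joining two queried nodes with different labels.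 The output is the partition into connected components of the final graph. The communities are *recovered up to a permutation* by a graph if it has exactly two connected components and these are $\sigma^{-1}(1)$ and $\sigma^{-1}(2)$. **Theorem.** Let $\theta_1>2\theta_2\ge 2$ and define $$t_1=\inf\Big\{t\ge0:(2\theta_2+t)\log\frac{2\theta_2+t}{2\theta_2}-t>1\Big\},$$ $$\eta=\inf\Big\{t\ge0:(\theta_1+\theta_2-2-t)\log\frac{\theta_1+\theta_2-2-t}{\theta_1+\theta_2-2}+t>1\Big\},\qquad E_T=(\theta_1+\theta_2-2-\eta)\frac{\log n}{n}.$$ Run the algorithm on $GBM(n,\sigma,\theta_1,\theta_2)$ with threshold $E_T$. 1. If $\theta_1-\theta_2-2-\eta>t_1$, then with probability $1-o(1)$ the graph $G_r$ obtained after Phase 1 recovers the communities up to a permutation. 2. If $0<\theta_1-\theta_2-2-\eta<t_1$, then with probability $1-o(1)$ the final graph after Phase 2 recovers the communities up to a permutation and the number of queries is at most $O\big(n^{1-\epsilon}(\log n)^3+\log n\big)$, where $$\epsilon=(\theta_1+\theta_2-2-\eta)\log\frac{\theta_1+\theta_2-2-\eta}{2\theta_2}-(\theta_1-\theta_2-2-\eta).$$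 The same holds if Phase 2 is moreover stopped once a prescribed query budget is used up, provided this budget is at least the bound on the number of queries. The $o(1)$ terms are as $n\to\infty$ and, like the constant in $O(\cdot)$, depend only on $\theta_1,\theta_2$ (not on $\sigma$, on the tie-breaking, or on the budget). -/

import Mathlib

open MeasureTheory

namespace GBM

/-! ### The geometric block model on the circle -/

/-- Distance of two points of `[0, 1]` on the circle of unit length. -/
noncomputable def torusDist (x y : ℝ) : ℝ := min |x - y| (1 - |x - y|)

/-- The law of `n` independent feature values, each uniform on `[0, 1]`. -/
noncomputable def featureMeasure (n : ℕ) : Measure (Fin n → ℝ) :=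
  Measure.pi fun _ => volume.restrict (Set.Icc (0 : ℝ) 1)

/-- The label assignment splits the nodes into two communities of equal size. -/
def IsBalanced {n : ℕ} (σ : Fin n → Fin 2) : Prop :=
  (Finset.univ.filter fun u => σ u = 0).card = (Finset.univ.filter fun u => σ u = 1).card

/-- The graph of the geometric block model with labels `σ` and feature values `X`: distinct nodes
are adjacent iff their distance is at most `θ₁ log n / n` (equal labels), respectively
`θ₂ log n / n` (different labels). -/
def graph {n : ℕ} (σ : Fin n → Fin 2) (θ₁ θ₂ : ℝ) (X : Fin n → ℝ) : SimpleGraph (Fin n) where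
  Adj u v := u ≠ v ∧
    torusDist (X u) (X v) ≤ (if σ u = σ v then θ₁ else θ₂) * (Real.log n / n)
  symm := by
    constructor
    rintro u v ⟨huv, h⟩
    refine ⟨huv.symm, ?_⟩
    simpa [torusDist, abs_sub_comm, eq_comm] using h
  loopless := ⟨fun _ h => h.1 rfl⟩

/-- A graph recovers the communities up to a permutation: its connected components, suitably
named by the two labels, give exactly the label assignment. -/
def Recovers {n : ℕ} (G : SimpleGraph (Fin n)) (σ : Fin n → Fin 2) : Prop :=
  ∃ π : G.ConnectedComponent ≃ Fin 2, ∀ u, π (G.connectedComponentMk u) = σ u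

/-! ### Phase 1: triangle counting -/

/-- The number of triangles of `G` that cover the pair `u, v`. -/
noncomputable def triangleCount {n : ℕ} (G : SimpleGraph (Fin n)) (u v : Fin n) : ℕ :=
  {z : Fin n | G.Adj u z ∧ G.Adj v z}.ncard

/-- Phase 1: remove every edge covered by at most `n * E_T` triangles of `G`. -/
def phaseOne {n : ℕ} (G : SimpleGraph (Fin n)) (E_T : ℝ) : SimpleGraph (Fin n) where
  Adj u v := G.Adj u v ∧ ¬ ((triangleCount G u v : ℝ) ≤ n * E_T)
  symm := by
    constructor
    rintro u v ⟨h, ht⟩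
    refine ⟨h.symm, ?_⟩
    simpa [triangleCount, and_comm] using ht
  loopless := ⟨fun u h => G.irrefl h.1⟩

/-! ### Phase 2: the S² algorithm

The list `L` holds the pairs (queried node, its label); its length is the number of queries. -/

/-- The graph left after the removal of all edges whose two ends are known to have different
labels. -/
def cutGraph {n : ℕ} (G : SimpleGraph (Fin n)) (L : List (Fin n × Fin 2)) :
    SimpleGraph (Fin n) where
  Adj u v := G.Adj u v ∧ ¬ ∃ a b : Fin 2, a ≠ b ∧ (u, a) ∈ L ∧ (v, b) ∈ L
  symm := by
    constructor
    rintro u v ⟨h, hL⟩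
    exact ⟨h.symm, fun ⟨a, b, hab, hu, hv⟩ => hL ⟨b, a, hab.symm, hv, hu⟩⟩
  loopless := ⟨fun u h => G.irrefl h.1⟩

/-- `x` is a midpoint of a shortest one among all paths of `G` between nodes that are known to have
different labels, and this path has length at least two. -/
def IsMSSP {n : ℕ} (G : SimpleGraph (Fin n)) (L : List (Fin n × Fin 2)) (x : Fin n) : Prop :=
  ∃ (u v : Fin n) (a b : Fin 2) (p : G.Walk u v),
    (u, a) ∈ L ∧ (v, b) ∈ L ∧ a ≠ b ∧
    (∀ (u' v' : Fin n) (a' b' : Fin 2) (q : G.Walk u' v'),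
      (u', a') ∈ L → (v', b') ∈ L → a' ≠ b' → p.length ≤ q.length) ∧
    2 ≤ p.length ∧ x = p.getVert (p.length / 2)

/-- An implementation of the subroutine MSSP, with an arbitrary way of breaking ties: it returns a
midpoint of a shortest path as above whenever there is one, and nothing otherwise. -/
def IsMSSPRule {n : ℕ}
    (rule : SimpleGraph (Fin n) → List (Fin n × Fin 2) → Option (Fin n)) : Prop :=
  ∀ G L, (∀ x, rule G L = some x → IsMSSP G L x) ∧ (rule G L = none → ∀ x, ¬ IsMSSP G L x)

open Classical in
/-- The nodes that have not been queried. -/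
noncomputable def unlabeled {n : ℕ} (L : List (Fin n × Fin 2)) : Finset (Fin n) :=
  Finset.univ.filter fun x => ∀ a, (x, a) ∉ L

open Classical in
/-- The S² algorithm on `G` with label oracle `f`, started from the list `L` and allowed the given
number of further queries. It stops as soon as the remaining graph has two disjoint components.
Otherwise it queries the node returned by MSSP if there is one, and else an unlabeled node picked
uniformly at random. The result is the law of the final list. -/
noncomputable def s2 {n : ℕ}
    (rule : SimpleGraph (Fin n) → List (Fin n × Fin 2) → Option (Fin n))
    (G : SimpleGraph (Fin n)) (f : Fin n → Fin 2) :
    ℕ → List (Fin n × Fin 2) → PMF (List (Fin n × Fin 2))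
  | 0, L => PMF.pure L
  | k + 1, L =>
    if 2 ≤ Nat.card (cutGraph G L).ConnectedComponent then PMF.pure L
    else
      match rule (cutGraph G L) L with
      | some x => s2 rule G f k ((x, f x) :: L)
      | none =>
        if h : (unlabeled L).Nonempty then
          (PMF.uniformOfFinset (unlabeled L) h).bind fun x => s2 rule G f k ((x, f x) :: L)
        else PMF.pure L

/-! ### The constants -/

/-- The constant `t₁`. -/
noncomputable def tOne (θ₂ : ℝ) : ℝ :=
  sInf {t : ℝ | 0 ≤ t ∧ (2 * θ₂ + t) * Real.log ((2 * θ₂ + t) / (2 * θ₂)) - t > 1}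

/-- The constant `η`. For `θ₁ + θ₂ - 2 > 1` the condition already holds at `t = θ₁ + θ₂ - 2`, so the
value of `Real.log` at negative numbers does not affect the infimum. -/
noncomputable def eta (θ₁ θ₂ : ℝ) : ℝ :=
  sInf {t : ℝ | 0 ≤ t ∧
    (θ₁ + θ₂ - 2 - t) * Real.log ((θ₁ + θ₂ - 2 - t) / (θ₁ + θ₂ - 2)) + t > 1}

/-- The threshold `E_T`. -/
noncomputable def threshold (θ₁ θ₂ : ℝ) (n : ℕ) : ℝ :=
  (θ₁ + θ₂ - 2 - eta θ₁ θ₂) * (Real.log n / n)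

/-- The exponent `ε` of the query complexity. -/
noncomputable def epsilon (θ₁ θ₂ : ℝ) : ℝ :=
  (θ₁ + θ₂ - 2 - eta θ₁ θ₂) * Real.log ((θ₁ + θ₂ - 2 - eta θ₁ θ₂) / (2 * θ₂))
    - (θ₁ - θ₂ - 2 - eta θ₁ θ₂)

/-- The rate `n ^ (1 - ε) * log³ n + log n`. -/
noncomputable def queryRate (θ₁ θ₂ : ℝ) (n : ℕ) : ℝ :=
  (n : ℝ) ^ (1 - epsilon θ₁ θ₂) * Real.log n ^ 3 + Real.log n

end GBM

/-! Write every distance as a multiple of `log n / n` and put `m = θ₁ + θ₂ - 2 - η`, so that Phase 1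
deletes the edges with at most `m log n` triangles.

Cross edges. If `u, v` lie in different communities, a common neighbor has the label of exactly one
of them, hence lies within `θ₂` of the other. The triangle count is therefore dominated by a sum of
independent indicators of mean about `2θ₂ log n`, and a Chernoff bound with parameter `s` gives
survival probability `n ^ -(s m - 2θ₂(e^s - 1))` (`measure_cross_edge_le`). About `n log n` cross
edges are expected before Phase 1. If `θ₁ - θ₂ - 2 - η > t₁`, some `s` makes the exponent exceed 1
and with high probability no cross edge survives; in the other regime the optimal `s` gives the
exponent `ε`, and Markov's inequality leaves at most `n ^ (1 - ε) log² n` of them.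

Inside a community only the edges between neighbors in the order of `[0, 1]` have to survive
(`sameGraph_reachable`). Gaps longer than `D > 2` are unlikely (`measure_gap_le`). For neighbors at
distance `ξ`, the emptiness of the interval between them and the Chernoff bound for the common
neighbors outside it are estimated together (`measure_consecutive_le`). The resulting exponent is
affine in `ξ`, and the definition of `η` makes it exceed 1 at `ξ = 0` and `ξ = 2`, hence slightly
beyond 2 (`exists_gap_exponent`). A union bound finishes.

Phase 2. With connected communities, a disconnected graph already recovers them
(`recovers_of_not_preconnected`), so stopping is always correct. Random queries find both labels
except with probability `2 ^ -j` after `1 + j` of them; then each query either halves the shortest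
path between opposite labels or removes a cross edge (`s2_of_pair`), which costs `O(log n)` queries
per surviving cross edge. -/

namespace GBM

/-! ### Integration over the features with two coordinates held fixed -/

section Product

open scoped ENNReal

variable {ι : Type*} [DecidableEq ι] {ν : Measure ℝ} [SigmaFinite ν]

/-- Given the coordinates `u, v`, the factors depend on separate coordinates. The induction
generalizes `F`, which absorbs each factor once it has been integrated. -/
theorem lmarginal_pair_mul_prod {u v : ι} (s : Finset ι) (hu : u ∉ s) (hv : v ∉ s)
    (F : ℝ × ℝ → ℝ≥0∞) (hF : Measurable F) (g : ι → (ℝ × ℝ) × ℝ → ℝ≥0∞)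
    (hg : ∀ z, Measurable (g z)) :
    (∫⋯∫⁻_s, (fun X : ι → ℝ => F (X u, X v) * ∏ z ∈ s, g z ((X u, X v), X z)) ∂fun _ => ν) =
      fun X => F (X u, X v) * ∏ z ∈ s, ∫⁻ t, g z ((X u, X v), t) ∂ν := by
  have hm : ∀ i : ι, Measurable fun X : ι → ℝ => X i := fun i => measurable_pi_apply i
  induction s using Finset.induction_on generalizing F with
  | empty => simp
  | insert i s hi ih =>
    have hui : u ≠ i := fun h => hu (by simp [h])
    have hvi : v ≠ i := fun h => hv (by simp [h])
    rw [lmarginal_insert' _ _ hi]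
    · have hG : Measurable fun p : ℝ × ℝ => F p * ∫⁻ t, g i (p, t) ∂ν :=
        hF.mul (hg i).lintegral_prod_right'
      have := ih (fun h => hu (Finset.mem_insert_of_mem h)) (fun h => hv (Finset.mem_insert_of_mem h))
        (fun p => F p * ∫⁻ t, g i (p, t) ∂ν) hG
      rw [show (fun x : ι → ℝ => ∫⁻ t, F (Function.update x i t u, Function.update x i t v) *
          ∏ z ∈ insert i s, g z ((Function.update x i t u, Function.update x i t v),
            Function.update x i t z) ∂ν) = fun X => (F (X u, X v) * ∫⁻ t, g i ((X u, X v), t) ∂ν) *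
          ∏ z ∈ s, g z ((X u, X v), X z) from ?_, this]
      · funext X
        rw [Finset.prod_insert hi, mul_assoc]
      · funext X
        have : ∀ t, F (Function.update X i t u, Function.update X i t v) *
          ∏ z ∈ insert i s, g z ((Function.update X i t u, Function.update X i t v),
            Function.update X i t z) =
          (F (X u, X v) * ∏ z ∈ s, g z ((X u, X v), X z)) * g i ((X u, X v), t) := by
          intro t
          rw [Finset.prod_insert hi]
          have : ∀ z ∈ s, g z ((Function.update X i t u, Function.update X i t v),
            Function.update X i t z) = g z ((X u, X v), X z) := by
            intro z hz
            have : z ≠ i := fun h => hi (h ▸ hz)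
            simp [Function.update_of_ne, *]
          rw [Finset.prod_congr rfl this]
          simp only [Function.update_of_ne hui, Function.update_of_ne hvi, Function.update_self]
          ring
        simp_rw [this]
        rw [lintegral_const_mul _ (show Measurable fun t => g i ((X u, X v), t) from
          (hg i).comp (measurable_const.prodMk measurable_id))]
        ring
    · refine (hF.comp ((hm u).prodMk (hm v))).mul (Finset.measurable_prod _ fun z _ => ?_)
      exact (hg z).comp (((hm u).prodMk (hm v)).prodMk (hm z))

variable [Fintype ι]

/-- Tonelli's theorem for a function of two coordinates multiplied by functions that involve one
further coordinate each. -/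
theorem lintegral_pair_mul_prod {u v : ι} (huv : u ≠ v)
    (F : ℝ × ℝ → ℝ≥0∞) (hF : Measurable F) (g : ι → (ℝ × ℝ) × ℝ → ℝ≥0∞)
    (hg : ∀ z, Measurable (g z)) :
    ∫⁻ X : ι → ℝ, F (X u, X v) * ∏ z ∈ {u, v}ᶜ, g z ((X u, X v), X z) ∂Measure.pi (fun _ => ν) =
      ∫⁻ p, F p * ∏ z ∈ {u, v}ᶜ, ∫⁻ t, g z (p, t) ∂ν ∂(ν.prod ν) := by
  have hm : ∀ i : ι, Measurable fun X : ι → ℝ => X i := fun i => measurable_pi_apply i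
  have hG : Measurable fun p : ℝ × ℝ => F p * ∏ z ∈ ({u, v}ᶜ : Finset ι), ∫⁻ t, g z (p, t) ∂ν :=
    hF.mul (Finset.measurable_prod _ fun z _ => (hg z).lintegral_prod_right')
  have hM : Measurable fun X : ι → ℝ =>
      F (X u, X v) * ∏ z ∈ ({u, v}ᶜ : Finset ι), g z ((X u, X v), X z) :=
    (hF.comp ((hm u).prodMk (hm v))).mul (Finset.measurable_prod _ fun z _ =>
      (hg z).comp (((hm u).prodMk (hm v)).prodMk (hm z)))
  rw [lintegral_eq_lmarginal_univ (0 : ι → ℝ), ← Finset.union_compl ({u, v} : Finset ι),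
    lmarginal_union _ _ hM disjoint_compl_right,
    lmarginal_pair_mul_prod _ (by simp) (by simp) F hF g hg,
    lmarginal_insert (fun X : ι → ℝ => F (X u, X v) * ∏ z ∈ ({u, v}ᶜ : Finset ι),
      ∫⁻ t, g z ((X u, X v), t) ∂ν) (hG.comp ((hm u).prodMk (hm v))) (by simpa using huv)]
  rw [lintegral_prod _ hG.aemeasurable]
  simp [lmarginal_singleton, Function.update_of_ne huv]

/-- Markov's inequality for a product of weights,
conditionally on two coordinates. -/
theorem measure_le_of_prod_weights {u v : ι} (huv : u ≠ v) {B : Set (ι → ℝ)} {S : Set (ℝ × ℝ)}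
    (hS : MeasurableSet S) (g : ι → (ℝ × ℝ) × ℝ → ℝ≥0∞) (hg : ∀ z, Measurable (g z))
    (K c : ℝ≥0∞)
    (hB : ∀ X ∈ B, (X u, X v) ∈ S ∧ 1 ≤ K * ∏ z ∈ {u, v}ᶜ, g z ((X u, X v), X z))
    (hc : ∀ p ∈ S, K * ∏ z ∈ ({u, v}ᶜ : Finset ι), ∫⁻ t, g z (p, t) ∂ν ≤ c) :
    Measure.pi (fun _ => ν) B ≤ c * (ν.prod ν) S := by
  have hm : ∀ i : ι, Measurable fun X : ι → ℝ => X i := fun i => measurable_pi_apply i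
  have hF : Measurable (S.indicator fun _ => K) := measurable_const.indicator hS
  have hM : Measurable fun X : ι → ℝ =>
      S.indicator (fun _ => K) (X u, X v) * ∏ z ∈ ({u, v}ᶜ : Finset ι), g z ((X u, X v), X z) :=
    (hF.comp ((hm u).prodMk (hm v))).mul (Finset.measurable_prod _ fun z _ =>
      (hg z).comp (((hm u).prodMk (hm v)).prodMk (hm z)))
  calc Measure.pi (fun _ => ν) B ≤ ∫⁻ X : ι → ℝ, S.indicator (fun _ => K) (X u, X v) *
        ∏ z ∈ {u, v}ᶜ, g z ((X u, X v), X z) ∂Measure.pi (fun _ => ν) := by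
        -- Only the weight has to be measurable: it is at least 1 on `B`, so `B` is enlarged to the
        -- set where this holds.
        refine le_trans (measure_mono ?_) ((one_mul _).symm.le.trans
          (mul_meas_ge_le_lintegral hM 1))
        intro X hX
        obtain ⟨h1, h2⟩ := hB X hX
        simpa [Set.indicator_of_mem h1] using h2
    _ = ∫⁻ p, S.indicator (fun _ => K) p * ∏ z ∈ {u, v}ᶜ, ∫⁻ t, g z (p, t) ∂ν ∂(ν.prod ν) :=
        lintegral_pair_mul_prod huv _ hF g hg
    _ ≤ ∫⁻ p, S.indicator (fun _ => c) p ∂(ν.prod ν) := by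
        refine lintegral_mono fun p => ?_
        by_cases hp : p ∈ S
        · simpa [hp] using hc p hp
        · simp [hp]
    _ = c * (ν.prod ν) S := by rw [lintegral_indicator hS]; simp

end Product

/-! ### Arc lengths on the circle and exponential bounds for one node -/

section Circle

/-- Every unit interval is a fundamental domain for the integer translations. Moving the window lets
an arc be measured where it does not wrap around. -/
theorem volume_inter_Icc_of_periodic {A : Set ℝ} (hA : MeasurableSet A)
    (hper : ∀ (k : ℤ) (x : ℝ), x + k ∈ A ↔ x ∈ A) (c : ℝ) :
    volume (A ∩ Set.Icc 0 1) = volume (A ∩ Set.Icc c (c + 1)) := by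
  have h := (isAddFundamentalDomain_Ioc one_pos (0 : ℝ)).measure_set_eq
    (isAddFundamentalDomain_Ioc one_pos c) hA ?_
  · have key : ∀ a b : ℝ, volume (A ∩ Set.Icc a b) = volume (A ∩ Set.Ioc a b) := fun a b =>
      measure_congr ((Filter.EventuallyEq.refl _ A).inter Ioc_ae_eq_Icc.symm)
    rw [key, key, ← h, zero_add]
  · rintro ⟨g, hg⟩
    obtain ⟨k, rfl⟩ := AddSubgroup.mem_zmultiples_iff.1 hg
    ext x
    have := hper k x
    simpa [AddSubgroup.vadd_def, add_comm] using this

/-- The union of the integer translates of a set. -/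
def translates (I : Set ℝ) : Set ℝ := ⋃ k : ℤ, (fun x : ℝ => x + k) ⁻¹' I

theorem mem_translates {I : Set ℝ} {x : ℝ} : x ∈ translates I ↔ ∃ k : ℤ, x + k ∈ I := by
  simp [translates]

theorem measurableSet_translates {I : Set ℝ} (hI : MeasurableSet I) :
    MeasurableSet (translates I) :=
  MeasurableSet.iUnion fun k => (measurable_id.add_const (k : ℝ)) hI

theorem volume_translates_inter_Icc {I : Set ℝ} (hI : MeasurableSet I) (c : ℝ) :
    volume (translates I ∩ Set.Icc 0 1) = volume (translates I ∩ Set.Icc c (c + 1)) := by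
  refine volume_inter_Icc_of_periodic (measurableSet_translates hI) (fun k x => ?_) c
  simp only [mem_translates]
  constructor
  · rintro ⟨j, hj⟩
    exact ⟨k + j, by push_cast; rwa [← add_assoc]⟩
  · rintro ⟨j, hj⟩
    exact ⟨j - k, by push_cast; convert hj using 1; ring⟩

theorem le_volume_translates_inter_Icc {I : Set ℝ} (hI : MeasurableSet I) {c : ℝ}
    (hc : I ⊆ Set.Icc c (c + 1)) : volume I ≤ volume (translates I ∩ Set.Icc 0 1) := by
  rw [volume_translates_inter_Icc hI c]
  exact measure_mono fun x hx => ⟨mem_translates.2 ⟨0, by simpa using hx⟩, hc hx⟩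

theorem torusDist_le_of_translate {p t r : ℝ} (hp : p ∈ Set.Icc (0 : ℝ) 1)
    (ht : t ∈ Set.Icc (0 : ℝ) 1) (k : ℤ) (h : |t + k - p| ≤ r) : torusDist p t ≤ r := by
  obtain ⟨hp0, hp1⟩ := hp
  obtain ⟨ht0, ht1⟩ := ht
  rw [abs_le] at h
  rcases lt_trichotomy k 0 with hk | rfl | hk
  · have : (k : ℝ) ≤ -1 := by exact_mod_cast Int.le_sub_one_of_lt hk
    refine (min_le_right _ _).trans ?_
    rcases abs_cases (p - t) with ⟨h1, h2⟩ | ⟨h1, h2⟩ <;> rw [h1] <;> linarith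
  · refine (min_le_left _ _).trans ?_
    rw [abs_sub_comm, abs_le]
    simpa using h
  · have : (1 : ℝ) ≤ k := by exact_mod_cast hk
    refine (min_le_right _ _).trans ?_
    rcases abs_cases (p - t) with ⟨h1, h2⟩ | ⟨h1, h2⟩ <;> rw [h1] <;> linarith

theorem measurable_torusDist : Measurable fun p : ℝ × ℝ => torusDist p.1 p.2 := by
  unfold torusDist
  fun_prop

instance : IsProbabilityMeasure (volume.restrict (Set.Icc (0 : ℝ) 1)) := ⟨by simp⟩

theorem torusDist_ball_le {p : ℝ} (hp : p ∈ Set.Icc (0 : ℝ) 1) (r : ℝ) :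
    volume.restrict (Set.Icc (0 : ℝ) 1) {t | torusDist p t ≤ r} ≤ ENNReal.ofReal (2 * r) := by
  rw [Measure.restrict_apply' measurableSet_Icc]
  calc volume ({t | torusDist p t ≤ r} ∩ Set.Icc 0 1)
      ≤ volume (translates (Set.Icc (p - r) (p + r)) ∩ Set.Icc 0 1) := by
        refine measure_mono ?_
        rintro t ⟨ht, ht'⟩
        refine ⟨?_, ht'⟩
        rw [mem_translates]
        obtain ⟨hp0, hp1⟩ := hp
        obtain ⟨ht0, ht1⟩ := ht'
        rcases min_le_iff.1 (show min _ _ ≤ r from ht) with h | h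
        · refine ⟨0, ?_⟩
          rw [abs_le] at h
          constructor <;> push_cast <;> linarith
        · rcases abs_cases (p - t) with ⟨h1, h2⟩ | ⟨h1, h2⟩ <;> rw [h1] at h
          · exact ⟨1, by push_cast; linarith, by push_cast; linarith⟩
          · exact ⟨-1, by push_cast; linarith, by push_cast; linarith⟩
    _ ≤ volume (Set.Icc (p - r) (p + r)) := by
        rw [volume_translates_inter_Icc measurableSet_Icc (p - 1 / 2)]
        refine measure_mono ?_
        rintro t ⟨ht, ht0, ht1⟩
        obtain ⟨k, hk0, hk1⟩ := mem_translates.1 ht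
        rcases lt_trichotomy k 0 with hk | rfl | hk
        · have : (k : ℝ) ≤ -1 := by exact_mod_cast Int.le_sub_one_of_lt hk
          constructor <;> linarith
        · simpa using And.intro hk0 hk1
        · have : (1 : ℝ) ≤ k := by exact_mod_cast hk
          constructor <;> linarith
    _ = ENNReal.ofReal (2 * r) := by rw [Real.volume_Icc]; congr 1; ring

theorem prod_torusDist_le (r : ℝ) :
    ((volume.restrict (Set.Icc (0 : ℝ) 1)).prod (volume.restrict (Set.Icc (0 : ℝ) 1)))
      {p | torusDist p.1 p.2 ≤ r} ≤ ENNReal.ofReal (2 * r) := by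
  rw [Measure.prod_apply (measurableSet_le measurable_torusDist measurable_const)]
  calc _ ≤ ∫⁻ _ in Set.Icc (0 : ℝ) 1, ENNReal.ofReal (2 * r) :=
        setLIntegral_mono' measurableSet_Icc fun x hx => torusDist_ball_le hx r
    _ = _ := by simp

theorem le_common_ball {p q r : ℝ} (hp : p ∈ Set.Icc (0 : ℝ) 1) (hq : q ∈ Set.Icc (0 : ℝ) 1)
    (hpq : p ≤ q) (hr : r ≤ 1 / 2) :
    ENNReal.ofReal (2 * r - (q - p)) ≤ volume.restrict (Set.Icc (0 : ℝ) 1)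
      {t | torusDist p t ≤ r ∧ torusDist q t ≤ r} := by
  rw [Measure.restrict_apply' measurableSet_Icc]
  calc ENNReal.ofReal (2 * r - (q - p)) = volume (Set.Icc (q - r) (p + r)) := by
        rw [Real.volume_Icc]; congr 1; ring
    _ ≤ _ := le_volume_translates_inter_Icc measurableSet_Icc (c := (p + q) / 2 - 1 / 2) ?_
    _ ≤ _ := measure_mono ?_
  · rintro t ⟨h1, h2⟩
    constructor <;> linarith
  · rintro t ⟨ht, ht'⟩
    obtain ⟨k, hk0, hk1⟩ := mem_translates.1 ht
    exact ⟨⟨torusDist_le_of_translate hp ht' k (abs_le.2 ⟨by linarith, by linarith⟩),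
      torusDist_le_of_translate hq ht' k (abs_le.2 ⟨by linarith, by linarith⟩)⟩, ht'⟩

/-- The common ball contains the arc from `q - r` to `p + r`; removing the stretch between `p` and
`q` leaves two arcs of length `r - (q - p)` each, which is where `q - p ≤ r` enters. -/
theorem le_common_ball_diff {p q r : ℝ} (hp : p ∈ Set.Icc (0 : ℝ) 1)
    (hq : q ∈ Set.Icc (0 : ℝ) 1) (hpq : p ≤ q) (hr : r ≤ 1 / 2) (hr' : q - p ≤ r) :
    ENNReal.ofReal (2 * r - 2 * (q - p)) ≤ volume.restrict (Set.Icc (0 : ℝ) 1)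
      {t | (torusDist p t ≤ r ∧ torusDist q t ≤ r) ∧ t ∉ Set.Ioo p q} := by
  rw [Measure.restrict_apply' measurableSet_Icc]
  have hm : MeasurableSet (Set.Ico (q - r) p ∪ Set.Ioc q (p + r)) :=
    measurableSet_Ico.union measurableSet_Ioc
  calc ENNReal.ofReal (2 * r - 2 * (q - p)) = volume (Set.Ico (q - r) p ∪ Set.Ioc q (p + r)) := by
        rw [measure_union _ measurableSet_Ioc, Real.volume_Ico, Real.volume_Ioc,
          ← ENNReal.ofReal_add (by linarith) (by linarith)]
        · congr 1; ring
        · rw [Set.disjoint_left]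
          rintro t ⟨_, h1⟩ ⟨h2, _⟩
          linarith
    _ ≤ _ := le_volume_translates_inter_Icc hm (c := (p + q) / 2 - 1 / 2) ?_
    _ ≤ _ := measure_mono ?_
  · rintro t (⟨h1, h2⟩ | ⟨h1, h2⟩) <;> constructor <;> linarith
  · rintro t ⟨ht, ht'⟩
    obtain ⟨k, hk⟩ := mem_translates.1 ht
    have hk' : q - r ≤ t + k ∧ t + k ≤ p + r := by
      rcases hk with ⟨h1, h2⟩ | ⟨h1, h2⟩ <;> constructor <;> linarith
    refine ⟨⟨⟨torusDist_le_of_translate hp ht' k (abs_le.2 ⟨by linarith, by linarith⟩),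
      torusDist_le_of_translate hq ht' k (abs_le.2 ⟨by linarith, by linarith⟩)⟩, ?_⟩, ht'⟩
    -- It is `t + k` that lies on the two outer arcs; a nonzero shift would put `t` outside `(p, q)`
    -- anyway, because `r ≤ 1 / 2`.
    rintro ⟨h1, h2⟩
    obtain ⟨hp0, hp1⟩ := hp
    obtain ⟨hq0, hq1⟩ := hq
    rcases lt_trichotomy k 0 with h | rfl | h
    · have : (k : ℝ) ≤ -1 := by exact_mod_cast Int.le_sub_one_of_lt h
      linarith
    · rcases hk with ⟨h3, h4⟩ | ⟨h3, h4⟩ <;> simp at * <;> linarith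
    · have : (1 : ℝ) ≤ k := by exact_mod_cast h
      linarith

/-- One node's factor in a lower-tail bound: weight 0 forbids `E`, weight `p` penalizes `A`. The
integral is `1 - ν E - (1 - p) ν A`, and `1 - y ≤ exp (-y)`. -/
theorem lintegral_weight_le {α : Type*} [MeasurableSpace α] (ν : Measure α)
    [IsProbabilityMeasure ν] {E A : Set α} (hE : MeasurableSet E) (hA : MeasurableSet A)
    (hEA : Disjoint E A) {p x a : ℝ} (hp0 : 0 ≤ p) (hp1 : p ≤ 1)
    (hx : ENNReal.ofReal x ≤ ν E) (ha : ENNReal.ofReal a ≤ ν A) [DecidablePred (· ∈ E)]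
    [DecidablePred (· ∈ A)] :
    ∫⁻ t, (if t ∈ E then 0 else if t ∈ A then ENNReal.ofReal p else 1) ∂ν ≤
      ENNReal.ofReal (Real.exp (-(x + (1 - p) * a))) := by
  have h1 : ∫⁻ t, (if t ∈ E then 0 else if t ∈ A then ENNReal.ofReal p else 1) ∂ν +
      (ν E + ENNReal.ofReal (1 - p) * ν A) = 1 := by
    have hw : Measurable fun t => (if t ∈ E then 0 else if t ∈ A then ENNReal.ofReal p else 1) :=
      Measurable.ite hE measurable_const (Measurable.ite hA measurable_const measurable_const)
    rw [← lintegral_indicator_one hE, ← lintegral_indicator_one hA, ← lintegral_const_mul _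
      (measurable_one.indicator hA), ← lintegral_add_left (measurable_one.indicator hE),
      ← lintegral_add_left hw]
    rw [show (1 : ENNReal) = ∫⁻ _, 1 ∂ν by simp]
    congr 1
    funext t
    have hp : ENNReal.ofReal p + ENNReal.ofReal (1 - p) = 1 := by
      rw [← ENNReal.ofReal_add hp0 (by linarith)]; simp
    by_cases h : t ∈ E
    · simp [h, Set.disjoint_left.1 hEA h]
    · by_cases h' : t ∈ A <;> simp [h, h', hp]
  set I := ∫⁻ t, (if t ∈ E then 0 else if t ∈ A then ENNReal.ofReal p else 1) ∂ν
  have hI : I ≤ 1 := h1 ▸ le_self_add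
  have h2 : I + (ENNReal.ofReal x + ENNReal.ofReal ((1 - p) * a)) ≤ 1 := by
    rw [← h1, ENNReal.ofReal_mul (by linarith)]
    gcongr
  have hfin : I ≠ ⊤ := ne_top_of_le_ne_top ENNReal.one_ne_top hI
  rw [← ENNReal.ofReal_toReal hfin]
  refine ENNReal.ofReal_le_ofReal (le_trans ?_ (Real.add_one_le_exp _))
  have h3 := ENNReal.toReal_mono ENNReal.one_ne_top h2
  rw [ENNReal.toReal_add hfin (by simp), ENNReal.toReal_add (by simp) (by simp)] at h3
  have h4 := (ENNReal.toReal_ofReal' (r := x)).symm ▸ le_max_left x 0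
  have h5 := (ENNReal.toReal_ofReal' (r := (1 - p) * a)).symm ▸ le_max_left ((1 - p) * a) 0
  simp only [ENNReal.toReal_one] at h3
  linarith

/-- The counterpart for upper tails, with a weight `w ≥ 1` that rewards hitting `A`. -/
theorem lintegral_weight_le' {α : Type*} [MeasurableSpace α] (ν : Measure α)
    [IsProbabilityMeasure ν] {A : Set α} (hA : MeasurableSet A) {w a : ℝ} (hw : 1 ≤ w)
    (ha : ν A ≤ ENNReal.ofReal a) (ha0 : 0 ≤ a) [DecidablePred (· ∈ A)] :
    ∫⁻ t, (if t ∈ A then ENNReal.ofReal w else 1) ∂ν ≤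
      ENNReal.ofReal (Real.exp ((w - 1) * a)) := by
  have h1 : (fun t => if t ∈ A then ENNReal.ofReal w else 1) =
      fun t => 1 + ENNReal.ofReal (w - 1) * A.indicator 1 t := by
    funext t
    by_cases h : t ∈ A
    · simp [h]
      rw [← ENNReal.ofReal_one, ← ENNReal.ofReal_add zero_le_one (by linarith)]; simp
    · simp [h]
  rw [h1, lintegral_add_left measurable_const, lintegral_const_mul _
      (measurable_one.indicator hA), lintegral_indicator_one hA]
  calc _ ≤ 1 + ENNReal.ofReal (w - 1) * ENNReal.ofReal a := by simp; gcongr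
    _ = ENNReal.ofReal (1 + (w - 1) * a) := by
      rw [ENNReal.ofReal_add zero_le_one (mul_nonneg (by linarith) ha0),
        ENNReal.ofReal_mul (by linarith)]; simp
    _ ≤ _ := ENNReal.ofReal_le_ofReal (by rw [add_comm]; exact Real.add_one_le_exp _)

end Circle

/-! ### Probabilities of the bad events for a fixed node or pair -/

section Events

variable {n : ℕ}

theorem featureMeasure_cube :
    ∀ᵐ X ∂featureMeasure n, ∀ u, X u ∈ Set.Icc (0 : ℝ) 1 := by
  rw [ae_all_iff]
  intro u
  have := (Measure.quasiMeasurePreserving_eval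
    (fun _ : Fin n => volume.restrict (Set.Icc (0 : ℝ) 1)) u).ae
    (ae_restrict_mem (μ := volume) (measurableSet_Icc (a := (0 : ℝ)) (b := 1)))
  exact this

instance : IsProbabilityMeasure (featureMeasure n) := by
  unfold featureMeasure; infer_instance

theorem IsBalanced.two_mul_card {σ : Fin n → Fin 2} (hσ : IsBalanced σ) (c : Fin 2) :
    2 * (Finset.univ.filter fun u => σ u = c).card = n := by
  have h1 : (Finset.univ.filter fun u => σ u = 0).card +
      (Finset.univ.filter fun u => σ u = 1).card = n := by
    have := Finset.card_filter_add_card_filter_not (s := (Finset.univ : Finset (Fin n)))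
      (fun u => σ u = 0)
    rw [Finset.card_univ, Fintype.card_fin] at this
    have h : (Finset.univ.filter fun u => ¬ σ u = 0) = Finset.univ.filter fun u => σ u = 1 := by
      ext u
      simp
      omega
    rwa [h] at this
  have h2 : (Finset.univ.filter fun u => σ u = 0).card =
      (Finset.univ.filter fun u => σ u = 1).card := by
    exact hσ
  have hc : c = 0 ∨ c = 1 := by omega
  rcases hc with rfl | rfl <;> omega

/-- The upper tail of the number of triangles that cover an edge between the communities. -/
theorem measure_cross_edge_le {σ : Fin n → Fin 2} (hn : 0 < n) {θ₁ θ₂ s m : ℝ} (hθ : 0 ≤ θ₂)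
    (hs : 0 ≤ s) {u v : Fin n} (huv : σ u ≠ σ v) :
    featureMeasure n {X | (∀ z, X z ∈ Set.Icc (0 : ℝ) 1) ∧ (graph σ θ₁ θ₂ X).Adj u v ∧
        m * Real.log n < triangleCount (graph σ θ₁ θ₂ X) u v} ≤
      ENNReal.ofReal (2 * (θ₂ * (Real.log n / n)) *
        Real.exp (-(s * m - 2 * θ₂ * (Real.exp s - 1)) * Real.log n)) := by
  classical
  set ℓ := Real.log n / n with hℓ
  have hn' : (0 : ℝ) < n := by exact_mod_cast hn
  have hℓ0 : 0 ≤ ℓ := div_nonneg (Real.log_natCast_nonneg n) hn'.le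
  have hne : u ≠ v := fun h => huv (h ▸ rfl)
  set S : Set (ℝ × ℝ) := {p | (p.1 ∈ Set.Icc (0 : ℝ) 1 ∧ p.2 ∈ Set.Icc (0 : ℝ) 1) ∧
    torusDist p.1 p.2 ≤ θ₂ * ℓ} with hS
  have hSm : MeasurableSet S :=
    ((measurable_fst measurableSet_Icc).inter (measurable_snd measurableSet_Icc)).inter
      (measurableSet_le measurable_torusDist measurable_const)
  -- A common neighbor has the label of one endpoint, hence lies within `θ₂` of the other. Keeping
  -- only this constraint makes the bound independent of the position of the pair.
  let A : Fin n → Set ((ℝ × ℝ) × ℝ) := fun z =>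
    {q | torusDist (if σ z = σ u then q.1.2 else q.1.1) q.2 ≤ θ₂ * ℓ}
  have hA : ∀ z, MeasurableSet (A z) := by
    intro z
    refine measurableSet_le ?_ measurable_const
    by_cases h : σ z = σ u
    · simp only [h, if_true]
      exact measurable_torusDist.comp (f := fun q : (ℝ × ℝ) × ℝ => (q.1.2, q.2)) (by fun_prop)
    · simp only [h, if_false]
      exact measurable_torusDist.comp (f := fun q : (ℝ × ℝ) × ℝ => (q.1.1, q.2)) (by fun_prop)
  have hes : 1 ≤ Real.exp s := Real.one_le_exp hs
  refine (measure_le_of_prod_weights (ν := volume.restrict (Set.Icc (0 : ℝ) 1)) hne hSm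
    (fun z q => if q ∈ A z then ENNReal.ofReal (Real.exp s) else 1)
    (fun z => Measurable.ite (hA z) measurable_const measurable_const)
    (ENNReal.ofReal (Real.exp (-(s * (m * Real.log n)))))
    (ENNReal.ofReal (Real.exp (-(s * m - 2 * θ₂ * (Real.exp s - 1)) * Real.log n)))
    ?_ ?_).trans ?_
  · rintro X ⟨hX, hadj, hcount⟩
    refine ⟨⟨⟨hX u, hX v⟩, ?_⟩, ?_⟩
    · have := hadj.2
      rwa [if_neg huv] at this
    · rw [Finset.prod_ite, Finset.prod_const_one, mul_one, Finset.prod_const,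
        ← ENNReal.ofReal_pow (Real.exp_pos _).le, ← ENNReal.ofReal_mul (Real.exp_pos _).le,
        ← Real.exp_nat_mul, ← Real.exp_add, ENNReal.one_le_ofReal, Real.one_le_exp_iff]
      have hle : triangleCount (graph σ θ₁ θ₂ X) u v ≤
          (Finset.filter (fun z => ((X u, X v), X z) ∈ A z) {u, v}ᶜ).card := by
        rw [← Set.ncard_coe_finset]
        refine Set.ncard_le_ncard ?_ (Set.toFinite _)
        rintro z ⟨⟨h1, h1'⟩, ⟨h2, h2'⟩⟩
        simp only [Finset.coe_filter, Finset.mem_compl, Finset.mem_insert, Finset.mem_singleton,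
          Set.mem_ofPred_eq, A]
        refine ⟨by rintro (rfl | rfl) <;> simp_all, ?_⟩
        by_cases h : σ z = σ u
        · rw [if_neg (fun h' : σ v = σ z => huv (h.symm.trans h'.symm))] at h2'
          simpa [h] using h2'
        · rw [if_neg (Ne.symm h)] at h1'
          simpa [h] using h1'
      have hle' : (triangleCount (graph σ θ₁ θ₂ X) u v : ℝ) ≤
          (Finset.filter (fun z => ((X u, X v), X z) ∈ A z) {u, v}ᶜ).card := by exact_mod_cast hle
      nlinarith [mul_le_mul_of_nonneg_right (hcount.le.trans hle') hs]
  · rintro ⟨x, y⟩ ⟨⟨hx, hy⟩, -⟩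
    have hz : ∀ z ∈ ({u, v}ᶜ : Finset (Fin n)),
        ∫⁻ t in Set.Icc (0 : ℝ) 1, (if ((x, y), t) ∈ A z then ENNReal.ofReal (Real.exp s) else 1) ≤
          ENNReal.ofReal (Real.exp ((Real.exp s - 1) * (2 * (θ₂ * ℓ)))) := by
      intro z _
      refine lintegral_weight_le' (volume.restrict (Set.Icc (0 : ℝ) 1))
        (A := {t | ((x, y), t) ∈ A z}) (measurable_prodMk_left (hA z)) hes ?_ (by positivity)
      refine torusDist_ball_le (p := if σ z = σ u then y else x) ?_ _
      split_ifs <;> assumption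
    calc _ ≤ ENNReal.ofReal (Real.exp (-(s * (m * Real.log n)))) *
          ∏ z ∈ ({u, v}ᶜ : Finset (Fin n)),
            ENNReal.ofReal (Real.exp ((Real.exp s - 1) * (2 * (θ₂ * ℓ)))) := by
          gcongr with z hz'
          exact hz z hz'
      _ ≤ _ := by
          rw [Finset.prod_const, ← ENNReal.ofReal_pow (Real.exp_pos _).le,
            ← ENNReal.ofReal_mul (Real.exp_pos _).le, ← Real.exp_nat_mul, ← Real.exp_add]
          refine ENNReal.ofReal_le_ofReal (Real.exp_le_exp.2 ?_)
          have hcard : (({u, v}ᶜ : Finset (Fin n)).card : ℝ) ≤ n := by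
            exact_mod_cast (Finset.card_le_univ _).trans_eq (by simp)
          have hlog : Real.log n = n * ℓ := by rw [hℓ]; field_simp
          have h0 : 0 ≤ (Real.exp s - 1) * (2 * (θ₂ * ℓ)) :=
            mul_nonneg (by linarith) (by positivity)
          rw [hlog]
          nlinarith [mul_le_mul_of_nonneg_right hcard h0]
  · rw [mul_comm, ENNReal.ofReal_mul (by positivity)]
    gcongr
    exact (measure_mono fun p hp => hp.2).trans (prod_torusDist_le _)

theorem card_filter_compl_pair_of_ne {σ : Fin n → Fin 2} (hσ : IsBalanced σ) {u v : Fin n}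
    (huv : σ u ≠ σ v) :
    ((({u, v}ᶜ : Finset (Fin n)).filter fun z => σ z = σ u).card : ℝ) = n / 2 - 1 := by
  have h : ({u, v}ᶜ : Finset (Fin n)).filter (fun z => σ z = σ u) =
      (Finset.univ.filter fun z => σ z = σ u).erase u := by
    ext z
    simp only [Finset.mem_filter, Finset.mem_compl, Finset.mem_insert, Finset.mem_singleton,
      Finset.mem_erase, Finset.mem_univ, true_and, not_or]
    exact ⟨fun h => ⟨h.1.1, h.2⟩, fun h => ⟨⟨h.1, fun h' => huv (h' ▸ h.2.symm)⟩, h.2⟩⟩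
  rw [h, Finset.card_erase_of_mem (by simp), Nat.cast_sub (Finset.card_pos.2 ⟨u, by simp⟩)]
  have := hσ.two_mul_card (σ u)
  have : (2 : ℝ) * (Finset.univ.filter fun z => σ z = σ u).card = n := by exact_mod_cast this
  push_cast
  linarith

theorem card_filter_compl_pair_of_eq {σ : Fin n → Fin 2} (hσ : IsBalanced σ) {u v : Fin n}
    (hne : u ≠ v) (huv : σ u = σ v) :
    ((({u, v}ᶜ : Finset (Fin n)).filter fun z => σ z = σ u).card : ℝ) = n / 2 - 2 ∧
    ((({u, v}ᶜ : Finset (Fin n)).filter fun z => ¬ σ z = σ u).card : ℝ) = n / 2 := by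
  have h : ({u, v}ᶜ : Finset (Fin n)).filter (fun z => σ z = σ u) =
      ((Finset.univ.filter fun z => σ z = σ u).erase u).erase v := by
    ext z
    simp only [Finset.mem_filter, Finset.mem_compl, Finset.mem_insert, Finset.mem_singleton,
      Finset.mem_erase, Finset.mem_univ, true_and, not_or]
    tauto
  have h1 : ((({u, v}ᶜ : Finset (Fin n)).filter fun z => σ z = σ u).card : ℝ) = n / 2 - 2 := by
    have hv : v ∈ (Finset.univ.filter fun z => σ z = σ u).erase u := by simp [hne.symm, huv]
    have hc : (Finset.univ.filter fun z => σ z = σ u).card =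
        (((Finset.univ.filter fun z => σ z = σ u).erase u).erase v).card + 2 := by
      rw [← Finset.card_erase_add_one (a := u) (by simp), ← Finset.card_erase_add_one hv]
    rw [h]
    have := hσ.two_mul_card (σ u)
    rw [hc] at this
    have : (2 : ℝ) * ((((Finset.univ.filter fun z => σ z = σ u).erase u).erase v).card + 2) = n := by
      exact_mod_cast this
    linarith
  refine ⟨h1, ?_⟩
  have h2 := Finset.card_filter_add_card_filter_not (s := ({u, v}ᶜ : Finset (Fin n)))
      (fun z => σ z = σ u)
  have h3 : ({u, v}ᶜ : Finset (Fin n)).card + 2 = n := by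
    rw [← Finset.card_pair hne, Finset.card_compl_add_card, Fintype.card_fin]
  have h4 : ((({u, v}ᶜ : Finset (Fin n)).filter fun z => σ z = σ u).card : ℝ) +
      (({u, v}ᶜ : Finset (Fin n)).filter fun z => ¬ σ z = σ u).card + 2 = n := by
    exact_mod_cast h2 ▸ h3
  linarith

/-- A community has no long gap. -/
theorem measure_gap_le {σ : Fin n → Fin 2} (hσ : IsBalanced σ) {d : ℝ}
    (u : Fin n) :
    featureMeasure n {X | (∀ z, X z ∈ Set.Icc (0 : ℝ) 1) ∧ X u ≤ 1 - d ∧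
        ∀ z, σ z = σ u → ¬ (X u < X z ∧ X z ≤ X u + d)} ≤
      ENNReal.ofReal (Real.exp (-((n / 2 - 1) * d))) := by
  classical
  -- The product lemma fixes two coordinates. A dummy `v` from the other community leaves all `n / 2
  -- - 1` other members of the community of `u` free.
  obtain ⟨v, hv⟩ : ∃ v, σ v ≠ σ u := by
    by_contra! h
    have h1 := hσ.two_mul_card (σ u + 1)
    have : (Finset.univ.filter fun z => σ z = σ u + 1) = ∅ := by
      ext z
      simp [h z]
    rw [this] at h1
    have := u.2
    simp at h1
    omega
  have hne : u ≠ v := fun h => hv (h ▸ rfl)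
  set S : Set (ℝ × ℝ) := {p | p.1 ∈ Set.Icc 0 (1 - d)} with hS
  have hSm : MeasurableSet S := measurable_fst measurableSet_Icc
  let E : Fin n → Set ((ℝ × ℝ) × ℝ) := fun z =>
    {q | σ z = σ u ∧ q.1.1 < q.2 ∧ q.2 ≤ q.1.1 + d}
  have hE : ∀ z, MeasurableSet (E z) := fun z =>
    (MeasurableSet.const _).inter
      ((measurableSet_lt measurable_fst.fst measurable_snd).inter
        (measurableSet_le measurable_snd (measurable_fst.fst.add_const d)))
  refine (measure_le_of_prod_weights (ν := volume.restrict (Set.Icc (0 : ℝ) 1)) hne hSm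
    (fun z q => if q ∈ E z then 0 else if q ∈ (∅ : Set ((ℝ × ℝ) × ℝ)) then ENNReal.ofReal 0 else 1)
    (fun z => Measurable.ite (hE z) measurable_const
      (Measurable.ite MeasurableSet.empty measurable_const measurable_const)) 1
    (ENNReal.ofReal (Real.exp (-((n / 2 - 1) * d)))) ?_ ?_).trans ?_
  · rintro X ⟨hX, hu, hz⟩
    refine ⟨⟨(hX u).1, hu⟩, ?_⟩
    rw [Finset.prod_eq_one]
    · simp
    · intro z _
      rw [if_neg (fun h => hz z h.1 h.2)]
      simp
  · rintro ⟨x, y⟩ ⟨hx0, hx1⟩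
    rw [one_mul]
    calc _ ≤ ∏ z ∈ ({u, v}ᶜ : Finset (Fin n)),
            ENNReal.ofReal (Real.exp (-((if σ z = σ u then d else 0) + (1 - 0) * 0))) := by
          gcongr with z hz'
          refine lintegral_weight_le (volume.restrict (Set.Icc (0 : ℝ) 1))
            (E := {t | ((x, y), t) ∈ E z}) (A := ∅) (measurable_prodMk_left (hE z))
            MeasurableSet.empty (by simp) le_rfl zero_le_one ?_ (by simp)
          split_ifs with h
          · rw [Measure.restrict_apply' measurableSet_Icc]
            have hd' : ENNReal.ofReal d = volume (Set.Ioc x (x + d)) := by simp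
            rw [hd']
            refine measure_mono fun t ht => ⟨⟨h, ht.1, ht.2⟩, hx0.trans ht.1.le, ?_⟩
            dsimp only at hx1
            linarith [ht.2]
          · simp
      _ ≤ _ := by
          rw [← ENNReal.ofReal_prod_of_nonneg fun _ _ => (Real.exp_pos _).le, ← Real.exp_sum]
          refine ENNReal.ofReal_le_ofReal (Real.exp_le_exp.2 ?_)
          simp only [mul_zero, add_zero, Finset.sum_neg_distrib, Finset.sum_ite,
            Finset.sum_const_zero, Finset.sum_const, nsmul_eq_mul]
          rw [card_filter_compl_pair_of_ne hσ (Ne.symm hv)]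
  · calc _ ≤ ENNReal.ofReal (Real.exp (-((n / 2 - 1) * d))) * 1 := by gcongr; exact prob_le_one
      _ = _ := mul_one _

/-- An edge between neighboring members of a community is rarely covered by few triangles. -/
theorem measure_consecutive_le {σ : Fin n → Fin 2} (hσ : IsBalanced σ) (hn : 0 < n)
    {θ₁ θ₂ m D p κ : ℝ} (hp0 : 0 < p) (hp1 : p ≤ 1) (hD0 : 0 ≤ D) (hD : D ≤ θ₁)
    (hr₁ : θ₁ * (Real.log n / n) ≤ 1 / 2) (hr₂ : θ₂ * (Real.log n / n) ≤ 1 / 2)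
    (hκ : ∀ ξ, 0 ≤ ξ → ξ ≤ D →
      κ ≤ (ξ + (1 - p) * (2 * θ₁ + 2 * θ₂ - 3 * ξ)) / 2 + m * Real.log p)
    {u v : Fin n} (hne : u ≠ v) (huv : σ u = σ v) :
    featureMeasure n {X | (∀ z, X z ∈ Set.Icc (0 : ℝ) 1) ∧ X u ≤ X v ∧
        X v - X u ≤ D * (Real.log n / n) ∧ (∀ z, σ z = σ u → ¬ (X u < X z ∧ X z < X v)) ∧
        (triangleCount (graph σ θ₁ θ₂ X) u v : ℝ) ≤ m * Real.log n} ≤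
      ENNReal.ofReal (Real.exp (2 * (Real.log n / n) * (D + 2 * θ₁) - κ * Real.log n) *
        (2 * (D * (Real.log n / n)))) := by
  classical
  set ℓ := Real.log n / n with hℓ
  have hn' : (0 : ℝ) < n := by exact_mod_cast hn
  have hℓ0 : 0 ≤ ℓ := div_nonneg (Real.log_natCast_nonneg n) hn'.le
  have hlog : Real.log n = n * ℓ := by rw [hℓ]; field_simp
  set S : Set (ℝ × ℝ) := {p | (p.1 ∈ Set.Icc (0 : ℝ) 1 ∧ p.2 ∈ Set.Icc (0 : ℝ) 1) ∧
    p.1 ≤ p.2 ∧ p.2 - p.1 ≤ D * ℓ} with hS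
  have hSm : MeasurableSet S :=
    ((measurable_fst measurableSet_Icc).inter (measurable_snd measurableSet_Icc)).inter
      ((measurableSet_le measurable_fst measurable_snd).inter
        (measurableSet_le (measurable_snd.sub measurable_fst) measurable_const))
  let E : Fin n → Set ((ℝ × ℝ) × ℝ) := fun z =>
    {q | σ z = σ u ∧ q.1.1 < q.2 ∧ q.2 < q.1.2}
  have hE : ∀ z, MeasurableSet (E z) := fun z =>
    (MeasurableSet.const _).inter
      ((measurableSet_lt measurable_fst.fst measurable_snd).inter
        (measurableSet_lt measurable_snd measurable_fst.snd))
  let A : Fin n → Set ((ℝ × ℝ) × ℝ) := fun z =>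
    {q | torusDist q.1.1 q.2 ≤ (if σ z = σ u then θ₁ else θ₂) * ℓ ∧
      torusDist q.1.2 q.2 ≤ (if σ z = σ u then θ₁ else θ₂) * ℓ} \ E z
  have hA : ∀ z, MeasurableSet (A z) := fun z =>
    ((measurableSet_le (measurable_torusDist.comp
        (f := fun q : (ℝ × ℝ) × ℝ => (q.1.1, q.2)) (by fun_prop)) measurable_const).inter
      (measurableSet_le (measurable_torusDist.comp
        (f := fun q : (ℝ × ℝ) × ℝ => (q.1.2, q.2)) (by fun_prop)) measurable_const)).diff (hE z)
  refine (measure_le_of_prod_weights (ν := volume.restrict (Set.Icc (0 : ℝ) 1)) hne hSm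
    -- Weight 0 on `E` charges for the empty interval, and weight `p` on `A` is the Chernoff tilt;
    -- since `A` excludes `E`, the two gains add up in one exponent.
    (fun z q => if q ∈ E z then 0 else if q ∈ A z then ENNReal.ofReal p else 1)
    (fun z => Measurable.ite (hE z) measurable_const
      (Measurable.ite (hA z) measurable_const measurable_const))
    (ENNReal.ofReal (Real.exp (-(m * Real.log n * Real.log p))))
    (ENNReal.ofReal (Real.exp (2 * ℓ * (D + 2 * θ₁) - κ * Real.log n)))
    ?_ ?_).trans ?_
  · rintro X ⟨hX, hle, hdist, hempty, hcount⟩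
    refine ⟨⟨⟨hX u, hX v⟩, hle, hdist⟩, ?_⟩
    have : ∀ z ∈ ({u, v}ᶜ : Finset (Fin n)), (if ((X u, X v), X z) ∈ E z then 0 else
        if ((X u, X v), X z) ∈ A z then ENNReal.ofReal p else 1) =
        if ((X u, X v), X z) ∈ A z then ENNReal.ofReal p else 1 := fun z _ =>
      if_neg fun h => hempty z h.1 h.2
    rw [Finset.prod_congr rfl this, Finset.prod_ite, Finset.prod_const_one, mul_one,
      Finset.prod_const, ← Real.exp_log hp0, Real.log_exp,
      ← ENNReal.ofReal_pow (Real.exp_pos _).le, ← ENNReal.ofReal_mul (Real.exp_pos _).le,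
      ← Real.exp_nat_mul, ← Real.exp_add, ENNReal.one_le_ofReal, Real.one_le_exp_iff]
    have hle : (Finset.filter (fun z => ((X u, X v), X z) ∈ A z) {u, v}ᶜ).card ≤
        triangleCount (graph σ θ₁ θ₂ X) u v := by
      rw [← Set.ncard_coe_finset]
      refine Set.ncard_le_ncard ?_ (Set.toFinite _)
      intro z hz
      simp only [Finset.coe_filter, Finset.mem_compl, Finset.mem_insert, Finset.mem_singleton,
        Set.mem_ofPred_eq, not_or] at hz
      obtain ⟨⟨h1, h2⟩, ⟨h3, h4⟩, -⟩ := hz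
      refine ⟨⟨Ne.symm h1, ?_⟩, Ne.symm h2, ?_⟩
      · simpa only [eq_comm] using h3
      · simpa only [eq_comm, huv] using h4
    have hle' : ((Finset.filter (fun z => ((X u, X v), X z) ∈ A z) {u, v}ᶜ).card : ℝ) ≤
        triangleCount (graph σ θ₁ θ₂ X) u v := by exact_mod_cast hle
    nlinarith [mul_le_mul_of_nonpos_right (hle'.trans hcount) (Real.log_nonpos hp0.le hp1)]
  · rintro ⟨x, y⟩ ⟨⟨hx, hy⟩, hxy, hyx⟩
    dsimp only at hx hy hxy hyx
    calc _ ≤ ENNReal.ofReal (Real.exp (-(m * Real.log n * Real.log p))) *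
          ∏ z ∈ ({u, v}ᶜ : Finset (Fin n)),
            ENNReal.ofReal (Real.exp (-((if σ z = σ u then y - x else 0) + (1 - p) *
              (if σ z = σ u then 2 * (θ₁ * ℓ) - 2 * (y - x) else 2 * (θ₂ * ℓ) - (y - x))))) := by
          gcongr with z hz'
          refine lintegral_weight_le (volume.restrict (Set.Icc (0 : ℝ) 1))
            (E := {t | ((x, y), t) ∈ E z}) (A := {t | ((x, y), t) ∈ A z})
            (measurable_prodMk_left (hE z)) (measurable_prodMk_left (hA z))
            (Set.disjoint_left.2 fun t h h' => h'.2 h) hp0.le hp1 ?_ ?_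
          · split_ifs with h
            · rw [Measure.restrict_apply' measurableSet_Icc]
              have hd' : ENNReal.ofReal (y - x) = volume (Set.Ioo x y) := by simp
              rw [hd']
              exact measure_mono fun t ht => ⟨⟨h, ht.1, ht.2⟩,
                hx.1.trans ht.1.le, ht.2.le.trans hy.2⟩
            · simp
          · split_ifs with h
            · refine (le_common_ball_diff hx hy hxy hr₁ (by nlinarith)).trans (measure_mono ?_)
              rintro t ⟨h1, h2⟩
              refine ⟨?_, fun h3 => h2 h3.2⟩
              simpa [h] using h1
            · refine (le_common_ball hx hy hxy hr₂).trans (measure_mono ?_)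
              rintro t h1
              refine ⟨?_, fun h3 => h h3.1⟩
              simpa [h] using h1
      _ ≤ _ := by
          rw [← ENNReal.ofReal_prod_of_nonneg fun _ _ => (Real.exp_pos _).le, ← Real.exp_sum,
            ← ENNReal.ofReal_mul (Real.exp_pos _).le, ← Real.exp_add]
          refine ENNReal.ofReal_le_ofReal (Real.exp_le_exp.2 ?_)
          obtain ⟨hc1, hc2⟩ := card_filter_compl_pair_of_eq hσ hne huv
          have hsum : ∑ z ∈ ({u, v}ᶜ : Finset (Fin n)),
              (-((if σ z = σ u then y - x else 0) + (1 - p) *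
                (if σ z = σ u then 2 * (θ₁ * ℓ) - 2 * (y - x) else 2 * (θ₂ * ℓ) - (y - x)))) =
              ∑ z ∈ ({u, v}ᶜ : Finset (Fin n)), (if σ z = σ u then
                (-((y - x) + (1 - p) * (2 * (θ₁ * ℓ) - 2 * (y - x)))) else
                (-((1 - p) * (2 * (θ₂ * ℓ) - (y - x))))) := by
            refine Finset.sum_congr rfl fun z _ => ?_
            split_ifs <;> ring
          rw [hsum, Finset.sum_ite, Finset.sum_const, Finset.sum_const, nsmul_eq_mul, nsmul_eq_mul,
            hc1, hc2]
          by_cases hℓ' : ℓ = 0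
          · have : y - x = 0 := le_antisymm (by simpa [hℓ'] using hyx) (by linarith)
            simp [hlog, hℓ', this]
          · have hℓ1 : 0 < ℓ := lt_of_le_of_ne hℓ0 (Ne.symm hℓ')
            obtain ⟨ξ, hξ⟩ : ∃ ξ, y - x = ξ * ℓ := ⟨(y - x) / ℓ, by field_simp⟩
            have hξ0 : 0 ≤ ξ := by
              by_contra! h
              nlinarith
            have hξD : ξ ≤ D := by
              rw [hξ] at hyx
              exact le_of_mul_le_mul_right hyx hℓ1
            have h := mul_le_mul_of_nonneg_right (hκ ξ hξ0 hξD)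
              (mul_nonneg hn'.le hℓ0)
            -- Excluding `u` and `v` leaves `n / 2 - 2` nodes of their community instead of `n / 2`.
            -- This bounds the two missing factors and produces the correction `2 ℓ (D + 2 θ₁)`.
            have h5 : ξ + (1 - p) * (2 * θ₁ - 2 * ξ) ≤ D + 2 * θ₁ := by nlinarith
            have h6 := mul_le_mul_of_nonneg_left h5 (mul_nonneg zero_le_two hℓ0)
            rw [hlog, hξ]
            nlinarith
  · rw [ENNReal.ofReal_mul (Real.exp_pos _).le]
    gcongr
    refine (measure_mono fun q hq => ?_).trans (prod_torusDist_le _)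
    refine (min_le_left |q.1 - q.2| _).trans ?_
    rw [abs_sub_comm, abs_of_nonneg (sub_nonneg.2 hq.2.1)]
    exact hq.2.2

end Events

/-! ### Connectivity of the communities and deterministic recovery -/

section Recovery

variable {n : ℕ}

/-- The subgraph of all edges inside the communities. -/
def sameGraph (G : SimpleGraph (Fin n)) (σ : Fin n → Fin 2) : SimpleGraph (Fin n) where
  Adj u v := G.Adj u v ∧ σ u = σ v
  symm := ⟨fun _ _ h => ⟨h.1.symm, h.2.symm⟩⟩
  loopless := ⟨fun _ h => G.irrefl h.1⟩

/-- From every member one steps to the next member on the right until a rightmost one, `M`, is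
reached; the induction is on the number of members strictly to the right. No edge across the point
`0 = 1` of the circle is needed. -/
theorem sameGraph_reachable {G : SimpleGraph (Fin n)} {σ : Fin n → Fin 2} {X : Fin n → ℝ} {d : ℝ}
    (hd : 0 ≤ d) (hX : ∀ z, X z ∈ Set.Icc (0 : ℝ) 1)
    (hgap : ∀ u, X u ≤ 1 - d → ∃ z, σ z = σ u ∧ X u < X z ∧ X z ≤ X u + d)
    (hcons : ∀ u v, u ≠ v → σ u = σ v → X u ≤ X v → X v - X u ≤ d →
      (∀ z, σ z = σ u → ¬ (X u < X z ∧ X z < X v)) → G.Adj u v)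
    {u v : Fin n} (huv : σ u = σ v) : (sameGraph G σ).Reachable u v := by
  classical
  obtain ⟨M, hM, hmax⟩ := (Finset.univ.filter fun z => σ z = σ u).exists_max_image X ⟨u, by simp⟩
  simp only [Finset.mem_filter, Finset.mem_univ, true_and] at hM hmax
  have key : ∀ (k : ℕ) (w : Fin n), σ w = σ u →
      (Finset.univ.filter fun z => σ z = σ u ∧ X w < X z).card = k →
      (sameGraph G σ).Reachable w M := by
    intro k
    induction k using Nat.strong_induction_on with
    | _ k ih =>
      intro w hw hk
      by_cases hwM : w = M
      · rw [hwM]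
      rcases (hmax w hw).eq_or_lt with h | h
      · have : G.Adj w M := hcons w M hwM (hw.trans hM.symm) h.le (by linarith)
          fun z _ hz => by linarith [hz.1, hz.2]
        exact SimpleGraph.Adj.reachable ⟨this, hw.trans hM.symm⟩
      · obtain ⟨y, hy, hmin⟩ := (Finset.univ.filter fun z => σ z = σ u ∧ X w < X z).exists_min_image
          X ⟨M, by simp [hM, h]⟩
        simp only [Finset.mem_filter, Finset.mem_univ, true_and] at hy hmin
        have hyd : X y - X w ≤ d := by
          by_cases hwd : X w ≤ 1 - d
          · obtain ⟨z, hz1, hz2, hz3⟩ := hgap w hwd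
            linarith [hmin z ⟨hz1.trans hw, hz2⟩]
          -- Near the right end no gap hypothesis is available, but `X y ≤ 1` bounds the step.
          · linarith [(hX y).2]
        have hadj : G.Adj w y := hcons w y (fun h' => by simp [h'] at hy) (hw.trans hy.1.symm)
          hy.2.le hyd fun z hz hz' => by linarith [hmin z ⟨hz.trans hw, hz'.1⟩, hz'.2]
        have hr : (sameGraph G σ).Reachable w y :=
          SimpleGraph.Adj.reachable ⟨hadj, hw.trans hy.1.symm⟩
        refine hr.trans (ih _ ?_ y hy.1 rfl)
        rw [← hk]
        refine Finset.card_lt_card (Finset.ssubset_iff_of_subset ?_ |>.2 ⟨y, by simp [hy], by simp⟩)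
        intro z hz
        simp only [Finset.mem_filter, Finset.mem_univ, true_and] at hz ⊢
        exact ⟨hz.1, hy.2.trans hz.2⟩
  exact (key _ u rfl rfl).trans (key _ v huv.symm rfl).symm

theorem IsBalanced.surjective {σ : Fin n → Fin 2} (hσ : IsBalanced σ) (hn : 0 < n) :
    Function.Surjective σ := by
  intro c
  have h := hσ.two_mul_card c
  have : 0 < (Finset.univ.filter fun u => σ u = c).card := by omega
  obtain ⟨u, hu⟩ := Finset.card_pos.1 this
  exact ⟨u, by simpa using hu⟩

/-- Each label class lies in one component, so a single connection between the classes would make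
the whole graph connected. -/
theorem recovers_of_not_preconnected {G : SimpleGraph (Fin n)} {σ : Fin n → Fin 2}
    (hσ : Function.Surjective σ) (hsame : ∀ u v, σ u = σ v → G.Reachable u v)
    (hG : ¬ G.Preconnected) : Recovers G σ := by
  have key : ∀ u v, G.Reachable u v → σ u = σ v := by
    intro u v huv
    by_contra hne
    refine hG fun a b => ?_
    have h : ∀ a, G.Reachable a u := by
      intro a
      by_cases ha : σ a = σ u
      · exact hsame a u ha
      · have : σ a = σ v := by omega
        exact (hsame a v this).trans huv.symm
    exact (h a).trans (h b).symm
  let f : G.ConnectedComponent → Fin 2 :=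
    SimpleGraph.ConnectedComponent.lift σ fun u v p _ => key u v p.reachable
  have hf : Function.Bijective f := by
    constructor
    · intro C D
      induction C using SimpleGraph.ConnectedComponent.ind with | _ u
      induction D using SimpleGraph.ConnectedComponent.ind with | _ v
      intro h
      exact SimpleGraph.ConnectedComponent.sound (hsame u v h)
    · intro c
      obtain ⟨u, rfl⟩ := hσ c
      exact ⟨G.connectedComponentMk u, rfl⟩
  exact ⟨Equiv.ofBijective f hf, fun u => rfl⟩

theorem sameGraph_le_cutGraph {G : SimpleGraph (Fin n)} {σ : Fin n → Fin 2}
    {L : List (Fin n × Fin 2)} (hL : ∀ q ∈ L, q.2 = σ q.1) : sameGraph G σ ≤ cutGraph G L := by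
  rintro u v ⟨h, huv⟩
  refine ⟨h, ?_⟩
  rintro ⟨a, b, hab, hu, hv⟩
  exact hab ((hL _ hu).trans (huv.trans (hL _ hv).symm))

theorem not_preconnected_of_no_cross {G : SimpleGraph (Fin n)} {σ : Fin n → Fin 2}
    (hσ : Function.Surjective σ) (h : ∀ u v, G.Adj u v → σ u = σ v) : ¬ G.Preconnected := by
  intro hG
  obtain ⟨u, hu⟩ := hσ 0
  obtain ⟨v, hv⟩ := hσ 1
  obtain ⟨p⟩ := hG u v
  have : ∀ {u v} (p : G.Walk u v), σ u = σ v := by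
    intro u v p
    induction p with
    | nil => rfl
    | cons hadj _ ih => exact (h _ _ hadj).trans ih
  have := this p
  omega

theorem preconnected_of_card_lt {G : SimpleGraph (Fin n)}
    (h : ¬ 2 ≤ Nat.card G.ConnectedComponent) : G.Preconnected := by
  have : Subsingleton G.ConnectedComponent :=
    Finite.card_le_one_iff_subsingleton.1 (by omega)
  exact fun u v => SimpleGraph.ConnectedComponent.exact (Subsingleton.elim _ _)

theorem not_preconnected_of_le_card {G : SimpleGraph (Fin n)}
    (h : 2 ≤ Nat.card G.ConnectedComponent) : ¬ G.Preconnected := by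
  intro hG
  have : Subsingleton G.ConnectedComponent := hG.subsingleton_connectedComponent
  have := Finite.card_le_one_iff_subsingleton.2 this
  omega

end Recovery

/-! ### Bisection once both labels are known -/

section Search

variable {n : ℕ} {G : SimpleGraph (Fin n)} {σ : Fin n → Fin 2}

/-- The pairs of adjacent nodes with different labels. -/
def crossPairs (G : SimpleGraph (Fin n)) (σ : Fin n → Fin 2) : Set (Fin n × Fin n) :=
  {q | G.Adj q.1 q.2 ∧ σ q.1 ≠ σ q.2}

/-- There is a walk of length at most `l` between nodes known to have different labels. -/
def HasShortWalk (G : SimpleGraph (Fin n)) (L : List (Fin n × Fin 2)) (l : ℕ) : Prop :=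
  ∃ (u v : Fin n) (a b : Fin 2) (p : G.Walk u v), (u, a) ∈ L ∧ (v, b) ∈ L ∧ a ≠ b ∧ p.length ≤ l

/-- Length 0 contradicts the oracle's consistency, and an edge between queried nodes of different
labels has been cut. -/
theorem HasShortWalk.two_le {L : List (Fin n × Fin 2)} {l : ℕ} (hL : ∀ q ∈ L, q.2 = σ q.1)
    (h : HasShortWalk (cutGraph G L) L l) : 2 ≤ l := by
  obtain ⟨u, v, a, b, p, hu, hv, hab, hp⟩ := h
  by_contra hl
  cases p with
  | nil => exact hab ((hL _ hu).trans (hL _ hv).symm)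
  | cons hadj q =>
    cases q with
    | nil => exact hadj.2 ⟨a, b, hab, hu, hv⟩
    | cons _ _ => simp at hp; omega

theorem exists_isMSSP {L : List (Fin n × Fin 2)} (hL : ∀ q ∈ L, q.2 = σ q.1) {l : ℕ}
    (h : HasShortWalk (cutGraph G L) L l) : ∃ x, IsMSSP (cutGraph G L) L x := by
  classical
  have hex : ∃ l, HasShortWalk (cutGraph G L) L l := ⟨l, h⟩
  have h2 := (Nat.find_spec hex).two_le hL
  obtain ⟨u, v, a, b, p, hu, hv, hab, hp⟩ := Nat.find_spec hex
  have hmin : ∀ (u' v' : Fin n) (a' b' : Fin 2) (q : (cutGraph G L).Walk u' v'),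
      (u', a') ∈ L → (v', b') ∈ L → a' ≠ b' → Nat.find hex ≤ q.length :=
    fun u' v' a' b' q h1 h2 h3 => Nat.find_min' hex ⟨u', v', a', b', q, h1, h2, h3, le_rfl⟩
  exact ⟨_, u, v, a, b, p, hu, hv, hab, fun u' v' a' b' q h1 h2 h3 =>
    hp.trans (hmin u' v' a' b' q h1 h2 h3), h2.trans (hmin u v a b p hu hv hab), rfl⟩

/-- Whatever label `c` the midpoint gets, it differs from that of one endpoint, so one half of the
path again joins opposite labels. The longer half has `⌈length / 2⌉` edges, and powers of two absorb
the rounding. -/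
theorem IsMSSP.hasShortWalk {G' : SimpleGraph (Fin n)} {L : List (Fin n × Fin 2)}
    {x : Fin n} {b : ℕ} (hx : IsMSSP G' L x) (h : HasShortWalk G' L (2 ^ b)) (c : Fin 2) :
    1 ≤ b ∧ HasShortWalk G' ((x, c) :: L) (2 ^ (b - 1)) := by
  obtain ⟨u, v, a₁, a₂, p, hu, hv, ha, hmin, hp2, rfl⟩ := hx
  obtain ⟨u', v', b₁, b₂, q, hu', hv', hb, hq⟩ := h
  have hpb : p.length ≤ 2 ^ b := (hmin u' v' b₁ b₂ q hu' hv' hb).trans hq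
  have hb1 : 1 ≤ b := by
    by_contra hb0
    have : b = 0 := by omega
    subst this
    simp at hpb
    omega
  obtain ⟨b, rfl⟩ := Nat.exists_eq_add_of_le' hb1
  rw [pow_succ] at hpb
  refine ⟨hb1, ?_⟩
  rw [Nat.add_sub_cancel]
  by_cases hc : c = a₁
  · refine ⟨_, v, c, a₂, p.drop (p.length / 2), by simp, by simp [hv], hc ▸ ha, ?_⟩
    rw [SimpleGraph.Walk.drop_length]
    omega
  · refine ⟨u, _, a₁, c, p.take (p.length / 2), by simp [hu], by simp, Ne.symm hc, ?_⟩
    rw [SimpleGraph.Walk.take_length]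
    omega

theorem cutGraph_cons_le (x : Fin n × Fin 2) (L : List (Fin n × Fin 2)) :
    cutGraph G (x :: L) ≤ cutGraph G L := by
  rintro u v ⟨h, h'⟩
  exact ⟨h, fun ⟨a, b, hab, hu, hv⟩ => h' ⟨a, b, hab, by simp [hu], by simp [hv]⟩⟩

theorem ncard_crossPairs_cons_lt {x : Fin n × Fin 2} {L : List (Fin n × Fin 2)}
    (hL : ∀ q ∈ x :: L, q.2 = σ q.1) (h : cutGraph G (x :: L) ≠ cutGraph G L) :
    (crossPairs (cutGraph G (x :: L)) σ).ncard < (crossPairs (cutGraph G L) σ).ncard := by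
  have hle := cutGraph_cons_le (G := G) x L
  have hnle : ¬ cutGraph G L ≤ cutGraph G (x :: L) := fun h' => h (le_antisymm hle h')
  have : ∃ u v, (cutGraph G L).Adj u v ∧ ¬ (cutGraph G (x :: L)).Adj u v := by
    by_contra! h'
    exact hnle fun u v => h' u v
  obtain ⟨u, v, huv, huv'⟩ := this
  refine Set.ncard_lt_ncard ?_ (Set.toFinite _)
  refine ⟨fun q hq => ⟨hle hq.1, hq.2⟩, fun hsub => ?_⟩
  have hcut : ∃ a b : Fin 2, a ≠ b ∧ (u, a) ∈ x :: L ∧ (v, b) ∈ x :: L := by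
    by_contra h'
    exact huv' ⟨huv.1, h'⟩
  obtain ⟨a, b, hab, hu, hv⟩ := hcut
  have hne : σ u ≠ σ v := fun h' => hab ((hL _ hu).trans (h'.trans (hL _ hv).symm))
  exact huv' (hsub (show (u, v) ∈ crossPairs (cutGraph G L) σ from ⟨huv, hne⟩)).1

theorem hasShortWalk_of_preconnected {G' : SimpleGraph (Fin n)} {L : List (Fin n × Fin 2)}
    {B : ℕ} (hB : n ≤ 2 ^ B) (hG : G'.Preconnected)
    (hpair : ∃ q ∈ L, ∃ q' ∈ L, q.2 ≠ q'.2) : HasShortWalk G' L (2 ^ B) := by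
  classical
  obtain ⟨q, hq, q', hq', hne⟩ := hpair
  obtain ⟨p, hp⟩ := (hG q.1 q'.1).exists_isPath
  refine ⟨q.1, q'.1, q.2, q'.2, p, hq, hq', hne, ?_⟩
  have := hp.length_lt
  rw [Fintype.card_fin] at this
  omega

variable {rule : SimpleGraph (Fin n) → List (Fin n × Fin 2) → Option (Fin n)}

/-- Once both labels are known, `S²` finds each edge between the communities by bisection. -/
theorem s2_of_pair (hrule : IsMSSPRule rule) (hσ : Function.Surjective σ)
    (hsame : ∀ u v, σ u = σ v → (sameGraph G σ).Reachable u v) {B : ℕ} (hB : n ≤ 2 ^ B)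
    (k : ℕ) (L : List (Fin n × Fin 2)) (e b : ℕ) (hL : ∀ q ∈ L, q.2 = σ q.1)
    (hpair : ∃ q ∈ L, ∃ q' ∈ L, q.2 ≠ q'.2)
    (he : (crossPairs (cutGraph G L) σ).ncard ≤ e)
    (hb : (cutGraph G L).Preconnected → HasShortWalk (cutGraph G L) L (2 ^ b))
    (hk : e * (B + 1) + b ≤ k) :
    ∀ L' ∈ (s2 rule G σ k L).support,
      Recovers (cutGraph G L') σ ∧ L'.length ≤ L.length + (e * (B + 1) + b) := by
  have hrec : ∀ L : List (Fin n × Fin 2), (∀ q ∈ L, q.2 = σ q.1) →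
      ¬ (cutGraph G L).Preconnected → Recovers (cutGraph G L) σ := fun L hL h =>
    recovers_of_not_preconnected hσ
      (fun u v huv => (hsame u v huv).mono (sameGraph_le_cutGraph hL)) h
  induction k generalizing L e b with
  | zero =>
    intro L' hL'
    simp only [s2, PMF.support_pure, Set.mem_singleton_iff] at hL'
    subst hL'
    refine ⟨hrec _ hL fun hpre => ?_, by omega⟩
    -- With the budget `e * (B + 1) + b` exhausted, a connected graph would contain a path of length
    -- at most 1 between opposite labels.
    have hb0 : b = 0 := by omega
    have := (hb hpre).two_le hL
    simp [hb0] at this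
  | succ k ih =>
    intro L' hL'
    rw [s2] at hL'
    by_cases hcard : 2 ≤ Nat.card (cutGraph G L).ConnectedComponent
    · rw [if_pos hcard] at hL'
      simp only [PMF.support_pure, Set.mem_singleton_iff] at hL'
      subst hL'
      exact ⟨hrec _ hL (not_preconnected_of_le_card hcard), by omega⟩
    · rw [if_neg hcard] at hL'
      have hpre := preconnected_of_card_lt hcard
      have hwalk := hb hpre
      cases hx : rule (cutGraph G L) L with
      | none =>
        obtain ⟨x, hx'⟩ := exists_isMSSP hL hwalk
        exact absurd hx' ((hrule _ _).2 hx x)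
      | some x =>
        rw [hx] at hL'
        have hx' := (hrule _ _).1 x hx
        have hL1 : ∀ q ∈ (x, σ x) :: L, q.2 = σ q.1 := by
          intro q hq
          rcases List.mem_cons.1 hq with rfl | hq
          · rfl
          · exact hL q hq
        have hpair1 : ∃ q ∈ (x, σ x) :: L, ∃ q' ∈ (x, σ x) :: L, q.2 ≠ q'.2 := by
          obtain ⟨q, hq, q', hq', hne⟩ := hpair
          exact ⟨q, by simp [hq], q', by simp [hq'], hne⟩
        -- The potential is `e * (B + 1) + b`. A query that cuts nothing lowers `b`; one that cuts
        -- an edge lowers `e` and resets `b` to at most `B`. Either way it drops by at least 1.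
        by_cases hcut : cutGraph G ((x, σ x) :: L) = cutGraph G L
        · obtain ⟨hb1, hwalk1⟩ := hx'.hasShortWalk hwalk (σ x)
          obtain ⟨h1, h2⟩ := ih ((x, σ x) :: L) e (b - 1) hL1 hpair1 (by rwa [hcut])
            (fun _ => by rwa [hcut]) (by omega) L' hL'
          refine ⟨h1, h2.trans ?_⟩
          simp only [List.length_cons]
          omega
        · have hlt := ncard_crossPairs_cons_lt hL1 hcut
          obtain ⟨e, rfl⟩ := Nat.exists_eq_add_of_le' (show 1 ≤ e by omega)
          rw [add_mul, one_mul] at hk ⊢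
          obtain ⟨h1, h2⟩ := ih ((x, σ x) :: L) e B hL1 hpair1 (by omega)
            (fun h => hasShortWalk_of_preconnected hB h hpair1) (by omega) L' hL'
          refine ⟨h1, h2.trans ?_⟩
          simp only [List.length_cons]
          omega

end Search

/-! ### Random queries until both labels are seen -/

section RandomPhase

open scoped ENNReal

variable {n : ℕ} {G : SimpleGraph (Fin n)} {σ : Fin n → Fin 2}
  {rule : SimpleGraph (Fin n) → List (Fin n × Fin 2) → Option (Fin n)}

theorem _root_.PMF.toOuterMeasure_le_one {α : Type*} (p : PMF α) (s : Set α) :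
    p.toOuterMeasure s ≤ 1 := by
  rw [PMF.toOuterMeasure_apply, ← p.tsum_coe]
  exact ENNReal.tsum_le_tsum fun x => Set.indicator_le_self _ _ x

theorem _root_.PMF.toOuterMeasure_bind_le {α β : Type*} (p : PMF α) (f : α → PMF β) (s : Set β)
    (t : Set α) (c : ℝ≥0∞) (ht : ∀ x ∈ t, (f x).toOuterMeasure s ≤ c)
    (ht' : ∀ x ∉ t, (f x).toOuterMeasure s = 0) :
    (p.bind f).toOuterMeasure s ≤ p.toOuterMeasure t * c := by
  classical
  rw [PMF.toOuterMeasure_bind_apply, PMF.toOuterMeasure_apply, ← ENNReal.tsum_mul_right]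
  refine ENNReal.tsum_le_tsum fun x => ?_
  by_cases hx : x ∈ t
  · rw [Set.indicator_of_mem hx]
    gcongr
    exact ht x hx
  · simp [ht' x hx]

theorem mem_unlabeled {L : List (Fin n × Fin 2)} {x : Fin n} :
    x ∈ unlabeled L ↔ ∀ a, (x, a) ∉ L := by simp [unlabeled]

/-- As long as only label `c` has been seen, the other community is entirely unqueried, so by
balance it makes up at least half of the candidates. -/
theorem uniform_unlabeled_le (hσ : IsBalanced σ) {L : List (Fin n × Fin 2)} (c : Fin 2)
    (hL : ∀ q ∈ L, q.2 = σ q.1 ∧ q.2 = c) (h : (unlabeled L).Nonempty) :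
    (PMF.uniformOfFinset (unlabeled L) h).toOuterMeasure {x | σ x = c} ≤ 1 / 2 := by
  classical
  rw [PMF.toOuterMeasure_uniformOfFinset_apply]
  have h1 : ((unlabeled L).filter fun x => σ x = c).card ≤
      ((unlabeled L).filter fun x => ¬ σ x = c).card := by
    have h2 : ((unlabeled L).filter fun x => ¬ σ x = c) =
        Finset.univ.filter fun x => σ x = c + 1 := by
      ext x
      simp only [Finset.mem_filter, mem_unlabeled, Finset.mem_univ, true_and]
      constructor
      · intro hx
        omega
      · intro hx
        have hne : σ x ≠ c := by omega
        exact ⟨fun a ha => hne ((hL _ ha).1.symm.trans (hL _ ha).2), hne⟩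
    rw [h2]
    calc ((unlabeled L).filter fun x => σ x = c).card
        ≤ (Finset.univ.filter fun x => σ x = c).card :=
          Finset.card_le_card (Finset.filter_subset_filter _ (Finset.subset_univ _))
      _ = _ := by
          have := hσ.two_mul_card c
          have := hσ.two_mul_card (c + 1)
          omega
  have h2 := Finset.card_filter_add_card_filter_not (s := unlabeled L) (fun x => σ x = c)
  have h3 : 2 * ((unlabeled L).filter fun x => σ x = c).card ≤ (unlabeled L).card := by omega
  rw [ENNReal.div_le_iff (by simpa using h.ne_empty) (by simp)]
  have h4 : (2 : ℝ≥0∞) * ((unlabeled L).filter fun x => σ x = c).card ≤ (unlabeled L).card := by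
    exact_mod_cast h3
  calc _ = (1 / 2 * 2 : ℝ≥0∞) * ((unlabeled L).filter fun x => σ x = c).card := by
        rw [ENNReal.div_mul_cancel two_ne_zero ENNReal.ofNat_ne_top, one_mul]
        congr 2
        ext x
        simp
    _ ≤ _ := by rw [mul_assoc]; gcongr

/-- The random phase of `S²` is short with high probability. -/
theorem s2_of_no_pair (hrule : IsMSSPRule rule) (hσ : IsBalanced σ) (hn : 0 < n)
    (hsame : ∀ u v, σ u = σ v → (sameGraph G σ).Reachable u v) {B : ℕ} (hB : n ≤ 2 ^ B)
    {e : ℕ} (he : (crossPairs G σ).ncard ≤ e) (j k T : ℕ) (L : List (Fin n × Fin 2)) (c : Fin 2)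
    (hL : ∀ q ∈ L, q.2 = σ q.1 ∧ q.2 = c) (hT : L.length + j + (e * (B + 1) + B) ≤ T)
    (hk : j + (e * (B + 1) + B) ≤ k) (hL0 : L ≠ []) :
    (s2 rule G σ k L).toOuterMeasure
      {L' | ¬ (Recovers (cutGraph G L') σ ∧ L'.length ≤ T)} ≤ (1 / 2) ^ j := by
  induction j generalizing k L with
  | zero => simpa using PMF.toOuterMeasure_le_one _ _
  | succ j ih =>
    obtain ⟨k, rfl⟩ := Nat.exists_eq_add_of_le' (show 1 ≤ k by omega)
    rw [s2]
    by_cases hcard : 2 ≤ Nat.card (cutGraph G L).ConnectedComponent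
    · rw [if_pos hcard]
      refine le_of_eq_of_le ?_ zero_le
      rw [PMF.toOuterMeasure_apply_eq_zero_iff, PMF.support_pure, Set.disjoint_singleton_left]
      refine fun h => h ⟨recovers_of_not_preconnected (hσ.surjective hn) (fun u v huv =>
        (hsame u v huv).mono (sameGraph_le_cutGraph fun q hq => (hL q hq).1))
        (not_preconnected_of_le_card hcard), by omega⟩
    · rw [if_neg hcard]
      have hnone : rule (cutGraph G L) L = none := by
        cases hx : rule (cutGraph G L) L with
        | none => rfl
        | some x =>
          obtain ⟨u, v, a, b, p, hu, hv, hab, -⟩ := (hrule _ _).1 x hx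
          exact absurd ((hL _ hu).2.trans (hL _ hv).2.symm) hab
      have hne : (unlabeled L).Nonempty := by
        obtain ⟨x, hx⟩ := hσ.surjective hn (c + 1)
        refine ⟨x, mem_unlabeled.2 fun a ha => ?_⟩
        have := (hL _ ha).1.symm.trans (hL _ ha).2
        dsimp only at this
        omega
      rw [hnone]
      dsimp only
      rw [dif_pos hne]
      -- Failure requires another draw of label `c`; the opposite label starts the bisection, which
      -- is deterministic in its guarantee and contributes failure probability 0.
      refine (PMF.toOuterMeasure_bind_le _ _ _ {x | σ x = c} ((1 / 2) ^ j) ?_ ?_).trans ?_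
      · intro x hx
        refine ih k ((x, σ x) :: L) ?_ ?_ (by omega) (by simp)
        · intro q hq
          rcases List.mem_cons.1 hq with rfl | hq
          · exact ⟨rfl, hx⟩
          · exact hL q hq
        · simp only [List.length_cons]
          omega
      · intro x hx
        have hL1 : ∀ q ∈ (x, σ x) :: L, q.2 = σ q.1 := by
          intro q hq
          rcases List.mem_cons.1 hq with rfl | hq
          · rfl
          · exact (hL q hq).1
        have hpair : ∃ q ∈ (x, σ x) :: L, ∃ q' ∈ (x, σ x) :: L, q.2 ≠ q'.2 := by
          obtain ⟨q, hq⟩ := List.exists_mem_of_ne_nil L hL0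
          refine ⟨(x, σ x), by simp, q, by simp [hq], fun h => hx ?_⟩
          exact h.trans (hL q hq).2
        have hle : (crossPairs (cutGraph G ((x, σ x) :: L)) σ).ncard ≤ e :=
          (Set.ncard_le_ncard (t := crossPairs G σ) (fun q hq => And.intro hq.1.1 hq.2)
            (Set.toFinite _)).trans he
        rw [PMF.toOuterMeasure_apply_eq_zero_iff, Set.disjoint_left]
        intro L' hL' hbad
        obtain ⟨h1, h2⟩ := s2_of_pair hrule (hσ.surjective hn) hsame hB k _ e B hL1 hpair hle
          (fun h => hasShortWalk_of_preconnected hB h hpair) (by omega) L' hL'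
        refine hbad ⟨h1, h2.trans ?_⟩
        simp only [List.length_cons]
        omega
      · rw [pow_succ, mul_comm]
        gcongr
        exact uniform_unlabeled_le hσ c hL hne

/-- A run of `S²` recovers the communities with few queries if the communities are connected and
few edges join them. -/
theorem s2_recovers (hrule : IsMSSPRule rule) (hσ : IsBalanced σ) (hn : 0 < n)
    (hsame : ∀ u v, σ u = σ v → (sameGraph G σ).Reachable u v) {B : ℕ} (hB : n ≤ 2 ^ B)
    {e : ℕ} (he : (crossPairs G σ).ncard ≤ e) (j k T : ℕ)
    (hT : 1 + j + (e * (B + 1) + B) ≤ T) (hk : T ≤ k) :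
    1 - (1 / 2) ^ j ≤ (s2 rule G σ k []).toOuterMeasure
      {L' | Recovers (cutGraph G L') σ ∧ L'.length ≤ T} := by
  have hbad : (s2 rule G σ k []).toOuterMeasure
      {L' | ¬ (Recovers (cutGraph G L') σ ∧ L'.length ≤ T)} ≤ (1 / 2) ^ j := by
    obtain ⟨k, rfl⟩ := Nat.exists_eq_add_of_le' (show 1 ≤ k by omega)
    rw [s2]
    by_cases hcard : 2 ≤ Nat.card (cutGraph G []).ConnectedComponent
    · rw [if_pos hcard]
      refine le_of_eq_of_le ?_ zero_le
      rw [PMF.toOuterMeasure_apply_eq_zero_iff, PMF.support_pure, Set.disjoint_singleton_left]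
      refine fun h => h ⟨recovers_of_not_preconnected (hσ.surjective hn) (fun u v huv =>
        (hsame u v huv).mono (sameGraph_le_cutGraph (by simp)))
        (not_preconnected_of_le_card hcard), by simp⟩
    · rw [if_neg hcard]
      have hnone : rule (cutGraph G []) [] = none := by
        cases hx : rule (cutGraph G []) [] with
        | none => rfl
        | some x =>
          obtain ⟨u, v, a, b, p, hu, -⟩ := (hrule _ _).1 x hx
          simp at hu
      have hne : (unlabeled ([] : List (Fin n × Fin 2))).Nonempty :=
        ⟨⟨0, hn⟩, mem_unlabeled.2 (by simp)⟩
      rw [hnone]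
      dsimp only
      rw [dif_pos hne]
      -- The first draw only fixes the label `c`; it gains no factor 1/2 and accounts for the extra
      -- 1 in `T`.
      refine (PMF.toOuterMeasure_bind_le _ _ _ Set.univ ((1 / 2) ^ j) ?_ (by simp)).trans ?_
      · intro x _
        refine s2_of_no_pair hrule hσ hn hsame hB he j k T [(x, σ x)] (σ x) ?_ ?_ ?_ (by simp)
        · simp
        · simp only [List.length_singleton]
          omega
        · omega
      · calc _ ≤ 1 * (1 / 2 : ℝ≥0∞) ^ j := by gcongr; exact PMF.toOuterMeasure_le_one _ _
          _ = _ := one_mul _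
  rw [tsub_le_iff_right]
  have huniv : (s2 rule G σ k []).toOuterMeasure Set.univ = 1 :=
    (PMF.toOuterMeasure_apply_eq_one_iff _ _).2 (Set.subset_univ _)
  calc 1 = (s2 rule G σ k []).toOuterMeasure Set.univ := huniv.symm
    _ ≤ (s2 rule G σ k []).toOuterMeasure
          ({L' | Recovers (cutGraph G L') σ ∧ L'.length ≤ T} ∪
            {L' | ¬ (Recovers (cutGraph G L') σ ∧ L'.length ≤ T)}) :=
        measure_mono fun L' _ => em _
    _ ≤ _ := (measure_union_le _ _).trans (by gcongr)

end RandomPhase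

/-! ### Union bounds and passage to probabilities of success -/

section Union

open scoped ENNReal

variable {n : ℕ} {σ : Fin n → Fin 2} {θ₁ θ₂ m D p κ E : ℝ}

theorem measure_exists_le {ι Ω : Type*} [Fintype ι] [MeasurableSpace Ω] (μ : Measure Ω)
    {P : ι → Ω → Prop} {c : ℝ} (h : ∀ i, μ {X | P i X} ≤ ENNReal.ofReal c) :
    μ {X | ∃ i, P i X} ≤ ENNReal.ofReal (Fintype.card ι * c) := by
  have hset : {X | ∃ i, P i X} = ⋃ i, {X | P i X} := by ext; simp
  rw [hset]
  calc μ (⋃ i, {X | P i X}) ≤ ∑ i, μ {X | P i X} := measure_iUnion_fintype_le _ _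
    _ ≤ ∑ _i : ι, ENNReal.ofReal c := Finset.sum_le_sum fun i _ => h i
    _ = ENNReal.ofReal (Fintype.card ι * c) := by
      rw [ENNReal.ofReal_mul (by positivity)]
      simp

/-- Phase 1 leaves the communities connected with high probability. -/
theorem measure_not_reachable_le (hσ : IsBalanced σ) (hn : 0 < n) (hp0 : 0 < p) (hp1 : p ≤ 1)
    (hD0 : 0 ≤ D) (hD : D ≤ θ₁)
    (hr₁ : θ₁ * (Real.log n / n) ≤ 1 / 2) (hr₂ : θ₂ * (Real.log n / n) ≤ 1 / 2)
    (hκ : ∀ ξ, 0 ≤ ξ → ξ ≤ D →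
      κ ≤ (ξ + (1 - p) * (2 * θ₁ + 2 * θ₂ - 3 * ξ)) / 2 + m * Real.log p)
    (hE : n * E = m * Real.log n) :
    featureMeasure n {X | ¬ ∀ u v, σ u = σ v →
        (sameGraph (phaseOne (graph σ θ₁ θ₂ X) E) σ).Reachable u v} ≤
      ENNReal.ofReal (n * Real.exp (-((n / 2 - 1) * (D * (Real.log n / n)))) +
        n * n * (Real.exp (2 * (Real.log n / n) * (D + 2 * θ₁) - κ * Real.log n) *
          (2 * (D * (Real.log n / n))))) := by
  set ℓ := Real.log n / n with hℓ
  have hn' : (0 : ℝ) < n := by exact_mod_cast hn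
  have hℓ0 : 0 ≤ ℓ := div_nonneg (Real.log_natCast_nonneg n) hn'.le
  have h1 := measure_exists_le (featureMeasure n)
    (P := fun u X => (∀ z, X z ∈ Set.Icc (0 : ℝ) 1) ∧ X u ≤ 1 - D * ℓ ∧
        ∀ z, σ z = σ u → ¬ (X u < X z ∧ X z ≤ X u + D * ℓ)) fun u => measure_gap_le hσ u
  have h2 := measure_exists_le (featureMeasure n) (ι := Fin n × Fin n)
    (P := fun q X => (q.1 ≠ q.2 ∧ σ q.1 = σ q.2) ∧ (∀ z, X z ∈ Set.Icc (0 : ℝ) 1) ∧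
        X q.1 ≤ X q.2 ∧ X q.2 - X q.1 ≤ D * ℓ ∧
        (∀ z, σ z = σ q.1 → ¬ (X q.1 < X z ∧ X z < X q.2)) ∧
        (triangleCount (graph σ θ₁ θ₂ X) q.1 q.2 : ℝ) ≤ m * Real.log n)
    (c := Real.exp (2 * ℓ * (D + 2 * θ₁) - κ * Real.log n) * (2 * (D * ℓ))) (by
      rintro ⟨u, v⟩
      by_cases h : u ≠ v ∧ σ u = σ v
      · refine (measure_mono fun X hX => hX.2).trans
          (measure_consecutive_le hσ hn hp0 hp1 hD0 hD hr₁ hr₂ hκ h.1 h.2)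
      · simp [h])
  rw [ENNReal.ofReal_add (by positivity) (by positivity)]
  have h0 : featureMeasure n {X | ¬ ∀ u, X u ∈ Set.Icc (0 : ℝ) 1} = 0 := featureMeasure_cube
  have hsub : ∀ (A B C : Set (Fin n → ℝ)) (a b : ℝ≥0∞), featureMeasure n A = 0 →
      featureMeasure n B ≤ a → featureMeasure n C ≤ b → featureMeasure n (A ∪ (B ∪ C)) ≤ a + b := by
    intro A B C a b hA hB hC
    refine (measure_union_le _ _).trans ?_
    rw [hA, zero_add]
    exact (measure_union_le _ _).trans (add_le_add hB hC)
  have := hsub _ _ _ _ _ h0 h1 h2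
  simp only [Fintype.card_prod, Fintype.card_fin, Nat.cast_mul] at this
  refine (measure_mono ?_).trans this
  intro X hX
  by_contra hcon
  simp only [Set.mem_union, Set.mem_ofPred_eq, not_or, not_not] at hcon
  obtain ⟨hcube, hgap, hcons⟩ := hcon
  refine hX fun u v huv => sameGraph_reachable (d := D * ℓ) (by positivity) hcube ?_ ?_ huv
  · intro u hu
    by_contra! h
    exact hgap ⟨u, hcube, hu, fun z hz hz' => absurd hz'.2 (not_le.2 (h z hz hz'.1))⟩
  · intro u v hne huv hle hd hbetween
    refine ⟨⟨hne, ?_⟩, fun h => hcons ⟨(u, v), ⟨hne, huv⟩, hcube, hle, hd, hbetween, ?_⟩⟩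
    · rw [if_pos huv]
      refine (min_le_left _ _).trans ?_
      rw [abs_sub_comm, abs_of_nonneg (by linarith)]
      exact hd.trans (by gcongr)
    · rwa [hE] at h

/-- Markov's inequality for the number of edges that join the communities after Phase 1. -/
theorem measure_crossPairs_le (hn : 0 < n) {s : ℝ} (hθ : 0 ≤ θ₂) (hs : 0 ≤ s)
    (hE : n * E = m * Real.log n) {K : ℝ} (hK : 0 < K) :
    featureMeasure n {X | K ≤ (crossPairs (phaseOne (graph σ θ₁ θ₂ X) E) σ).ncard} ≤
      ENNReal.ofReal (n * n * (2 * (θ₂ * (Real.log n / n)) *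
        Real.exp (-(s * m - 2 * θ₂ * (Real.exp s - 1)) * Real.log n)) / K) := by
  classical
  set c := 2 * (θ₂ * (Real.log n / n)) *
        Real.exp (-(s * m - 2 * θ₂ * (Real.exp s - 1)) * Real.log n) with hc
  have hn' : (0 : ℝ) < n := by exact_mod_cast hn
  have hc0 : 0 ≤ c := by
    have : 0 ≤ Real.log n / n := div_nonneg (Real.log_natCast_nonneg n) hn'.le
    positivity
  let B : Fin n × Fin n → Set (Fin n → ℝ) := fun q =>
    {X | σ q.1 ≠ σ q.2 ∧ (∀ z, X z ∈ Set.Icc (0 : ℝ) 1) ∧ (graph σ θ₁ θ₂ X).Adj q.1 q.2 ∧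
        m * Real.log n < triangleCount (graph σ θ₁ θ₂ X) q.1 q.2}
  -- Measurable hulls allow the count to be integrated without proving the events measurable.
  have hB : ∀ q, featureMeasure n (toMeasurable (featureMeasure n) (B q)) ≤ ENNReal.ofReal c := by
    rintro ⟨u, v⟩
    rw [measure_toMeasurable]
    by_cases h : σ u ≠ σ v
    · exact (measure_mono fun X hX => hX.2).trans (measure_cross_edge_le hn hθ hs h)
    · simp [B, h]
  clear_value c
  have hmeas : Measurable fun X => ∑ q, (toMeasurable (featureMeasure n) (B q)).indicator
      (1 : (Fin n → ℝ) → ℝ≥0∞) X :=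
    Finset.measurable_sum _ fun q _ =>
      measurable_one.indicator (measurableSet_toMeasurable _ _)
  have hint : ∫⁻ X, ∑ q, (toMeasurable (featureMeasure n) (B q)).indicator
      (1 : (Fin n → ℝ) → ℝ≥0∞) X ∂featureMeasure n ≤ ENNReal.ofReal (n * n * c) := by
    rw [lintegral_finsetSum _ fun q _ =>
      measurable_one.indicator (measurableSet_toMeasurable _ _)]
    calc _ ≤ ∑ _q : Fin n × Fin n, ENNReal.ofReal c := by
          refine Finset.sum_le_sum fun q _ => ?_
          rw [lintegral_indicator_one (measurableSet_toMeasurable _ _)]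
          exact hB q
      _ = _ := by
        rw [ENNReal.ofReal_mul (by positivity), ENNReal.ofReal_mul (by positivity)]
        simp
  have hmarkov := meas_ge_le_lintegral_div (μ := featureMeasure n) hmeas.aemeasurable
    (ε := ENNReal.ofReal K) (by simpa using hK) ENNReal.ofReal_ne_top
  have h0 : featureMeasure n {X | ¬ ∀ u, X u ∈ Set.Icc (0 : ℝ) 1} = 0 := featureMeasure_cube
  rw [ENNReal.ofReal_div_of_pos hK]
  refine le_trans ?_ (hmarkov.trans (ENNReal.div_le_div_right hint _))
  refine (measure_mono (t := {X | ¬ ∀ u, X u ∈ Set.Icc (0 : ℝ) 1} ∪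
    {X | ENNReal.ofReal K ≤ ∑ q, (toMeasurable (featureMeasure n) (B q)).indicator
      (1 : (Fin n → ℝ) → ℝ≥0∞) X}) ?_).trans ((measure_union_le _ _).trans (by rw [h0, zero_add]))
  intro X hX
  by_cases hcube : ∀ u, X u ∈ Set.Icc (0 : ℝ) 1
  swap
  · exact Or.inl hcube
  right
  have hle : (crossPairs (phaseOne (graph σ θ₁ θ₂ X) E) σ).ncard ≤
      (Finset.univ.filter fun q => X ∈ toMeasurable (featureMeasure n) (B q)).card := by
    rw [← Set.ncard_coe_finset]
    refine Set.ncard_le_ncard ?_ (Set.toFinite _)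
    rintro ⟨u, v⟩ ⟨⟨hadj, hcount⟩, hne⟩
    simp only [Finset.coe_filter, Finset.mem_univ, true_and, Set.mem_ofPred_eq]
    refine subset_toMeasurable _ _ ⟨hne, hcube, hadj, ?_⟩
    rwa [hE, not_le] at hcount
  have hX' : K ≤ (crossPairs (phaseOne (graph σ θ₁ θ₂ X) E) σ).ncard := hX
  calc ENNReal.ofReal K ≤ ENNReal.ofReal
        (Finset.univ.filter fun q => X ∈ toMeasurable (featureMeasure n) (B q)).card :=
        ENNReal.ofReal_le_ofReal (hX'.trans (by exact_mod_cast hle))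
    _ = _ := by
      rw [ENNReal.ofReal_natCast, Finset.card_filter]
      push_cast
      rfl

/-- This combines the randomness of the features (failure `b`) with that of the algorithm (failure
`a`). The success probability `f` is bounded below off a measurable hull of `S`, so neither `f` nor
`S` has to be measurable. -/
theorem le_lintegral_of_measure_le {Ω : Type*} [MeasurableSpace Ω] (μ : Measure Ω)
    [IsProbabilityMeasure μ] {S : Set Ω} {f : Ω → ℝ≥0∞} {a b : ℝ} (ha : 0 ≤ a) (hb : 0 ≤ b)
    (hS : μ S ≤ ENNReal.ofReal b) (hf : ∀ X ∉ S, ENNReal.ofReal (1 - a) ≤ f X) :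
    ENNReal.ofReal (1 - (a + b)) ≤ ∫⁻ X, f X ∂μ := by
  by_cases ha1 : 1 < a
  · rw [ENNReal.ofReal_of_nonpos (by linarith)]
    exact zero_le
  have hT := measurableSet_toMeasurable μ S
  calc ENNReal.ofReal (1 - (a + b)) ≤ ENNReal.ofReal ((1 - a) * (1 - b)) :=
        ENNReal.ofReal_le_ofReal (by nlinarith)
    _ = ENNReal.ofReal (1 - a) * ENNReal.ofReal (1 - b) := ENNReal.ofReal_mul (by linarith)
    _ ≤ ENNReal.ofReal (1 - a) * μ (toMeasurable μ S)ᶜ := by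
        gcongr
        rw [prob_compl_eq_one_sub hT, measure_toMeasurable, ENNReal.ofReal_sub _ hb,
          ENNReal.ofReal_one]
        gcongr
    _ = ∫⁻ _ in (toMeasurable μ S)ᶜ, ENNReal.ofReal (1 - a) ∂μ := by simp
    _ ≤ ∫⁻ X in (toMeasurable μ S)ᶜ, f X ∂μ := setLIntegral_mono' hT.compl fun X hX =>
        hf X fun h => hX (subset_toMeasurable μ S h)
    _ ≤ ∫⁻ X, f X ∂μ := setLIntegral_le_lintegral _ _

theorem le_measure_of_compl_subset {Ω : Type*} [MeasurableSpace Ω] (μ : Measure Ω)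
    [IsProbabilityMeasure μ] {S T : Set Ω} {b : ℝ} (hb : 0 ≤ b)
    (hS : μ S ≤ ENNReal.ofReal b) (h : ∀ X ∉ S, X ∈ T) :
    ENNReal.ofReal (1 - b) ≤ μ T := by
  rw [ENNReal.ofReal_sub _ hb, ENNReal.ofReal_one, tsub_le_iff_right]
  calc (1 : ℝ≥0∞) = μ Set.univ := measure_univ.symm
    _ ≤ μ (T ∪ S) := measure_mono fun X _ => (em (X ∈ S)).elim Or.inr fun hX => Or.inl (h X hX)
    _ ≤ _ := (measure_union_le _ _).trans (by gcongr)

end Union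

/-! ### The exponents supplied by `t₁` and `η` -/

section Constants

variable {θ₁ θ₂ : ℝ}

theorem eta_nonneg : 0 ≤ eta θ₁ θ₂ := Real.sInf_nonneg fun _ ht => ht.1

theorem tOne_nonneg : 0 ≤ tOne θ₂ := Real.sInf_nonneg fun _ ht => ht.1

/-- The infimum lies in the closure of its set, and the strict inequality becomes weak in the limit.
Continuity up to `t = θ₁ + θ₂ - 2` is that of `x log x` at 0. -/
theorem one_le_eta_rate (h : 1 < θ₁ + θ₂ - 2) :
    1 ≤ (θ₁ + θ₂ - 2 - eta θ₁ θ₂) *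
      Real.log ((θ₁ + θ₂ - 2 - eta θ₁ θ₂) / (θ₁ + θ₂ - 2)) + eta θ₁ θ₂ := by
  set a := θ₁ + θ₂ - 2 with ha
  set S : Set ℝ := {t : ℝ | 0 ≤ t ∧ (a - t) * Real.log ((a - t) / a) + t > 1} with hS
  have hne : S.Nonempty := ⟨a, by linarith, by simpa using h⟩
  have hbdd : BddBelow S := ⟨0, fun t ht => ht.1⟩
  have hcont : Continuous fun t : ℝ => a * ((a - t) / a * Real.log ((a - t) / a)) + t :=
    (continuous_const.mul (Real.continuous_mul_log.comp (by fun_prop))).add continuous_id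
  have hclosed : IsClosed {t : ℝ | 1 ≤ a * ((a - t) / a * Real.log ((a - t) / a)) + t} :=
    isClosed_le continuous_const hcont
  have heq : ∀ t, a * ((a - t) / a * Real.log ((a - t) / a)) = (a - t) * Real.log ((a - t) / a) :=
    fun t => by field_simp
  have hmem := closure_minimal (s := S) (fun t ht => by
    simp only [Set.mem_ofPred_eq, heq]
    exact ht.2.le) hclosed (csInf_mem_closure hne hbdd)
  simp only [Set.mem_ofPred_eq, heq] at hmem
  exact hmem

/-- Pick `t' < t` in the set defining `t₁` and the Chernoff parameter `s` that is optimal for `t'`.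
For fixed `s` the exponent increases with `t`, so monotonicity of the rate function itself is not
needed. -/
theorem exists_lt_of_tOne_lt (h₂ : 1 ≤ θ₂) {t : ℝ} (ht : tOne θ₂ < t) :
    ∃ s, 0 ≤ s ∧ 1 < s * (2 * θ₂ + t) - 2 * θ₂ * (Real.exp s - 1) := by
  set S : Set ℝ := {t : ℝ | 0 ≤ t ∧ (2 * θ₂ + t) * Real.log ((2 * θ₂ + t) / (2 * θ₂)) - t > 1}
    with hS
  have hne : S.Nonempty := by
    refine ⟨2 * θ₂ * (Real.exp 2 - 1), ?_, ?_⟩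
    · have := Real.one_le_exp (zero_le_two (α := ℝ))
      nlinarith
    · have : (2 * θ₂ + 2 * θ₂ * (Real.exp 2 - 1)) / (2 * θ₂) = Real.exp 2 := by field_simp; ring
      rw [this, Real.log_exp]
      nlinarith [Real.exp_pos 2]
  obtain ⟨t', ⟨ht0, ht1⟩, htt⟩ := exists_lt_of_csInf_lt hne ht
  have h3 : 1 ≤ (2 * θ₂ + t') / (2 * θ₂) := by
    rw [le_div_iff₀ (by linarith)]; linarith
  refine ⟨Real.log ((2 * θ₂ + t') / (2 * θ₂)), Real.log_nonneg h3, ?_⟩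
  rw [Real.exp_log (by linarith)]
  have h4 : 2 * θ₂ * ((2 * θ₂ + t') / (2 * θ₂) - 1) = t' := by field_simp; ring
  rw [h4]
  nlinarith [Real.log_nonneg h3]

theorem rate_le_one_of_lt_tOne {t : ℝ} (ht0 : 0 ≤ t) (ht : t < tOne θ₂) :
    (2 * θ₂ + t) * Real.log ((2 * θ₂ + t) / (2 * θ₂)) - t ≤ 1 := by
  by_contra! h
  exact absurd (csInf_le ⟨0, fun t ht => ht.1⟩ (show t ∈ {t : ℝ | 0 ≤ t ∧
    (2 * θ₂ + t) * Real.log ((2 * θ₂ + t) / (2 * θ₂)) - t > 1} from ⟨ht0, h⟩)) (not_le.2 ht)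

/-- With `a = θ₁ + θ₂ - 2` and `p = (a - η) / a`, the inequality for `η` says `(1 - p) a + (a - η)
log p ≥ 1`. The exponent is then at least `1 + 2 (1 - p) + ξ (3p / 2 - 1)`, equal to `3 - 2p` at `ξ
= 0` and to `1 + p` at `ξ = 2`; both exceed 1 because `0 < p < 1`. -/
theorem exists_gap_exponent (h₁ : 2 < θ₁) (h₂ : 1 ≤ θ₂)
    (ht : 0 < θ₁ + θ₂ - 2 - eta θ₁ θ₂) :
    ∃ p D κ : ℝ, 0 < p ∧ p ≤ 1 ∧ 2 < D ∧ D ≤ θ₁ ∧ 1 < κ ∧ ∀ ξ, 0 ≤ ξ → ξ ≤ D →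
      κ ≤ (ξ + (1 - p) * (2 * θ₁ + 2 * θ₂ - 3 * ξ)) / 2 +
        (θ₁ + θ₂ - 2 - eta θ₁ θ₂) * Real.log p := by
  have hrate := one_le_eta_rate (θ₁ := θ₁) (θ₂ := θ₂) (by linarith)
  have hη0 := eta_nonneg (θ₁ := θ₁) (θ₂ := θ₂)
  set η := eta θ₁ θ₂
  obtain ⟨a, ha⟩ : ∃ a, a = θ₁ + θ₂ - 2 := ⟨_, rfl⟩
  rw [← ha] at ht hrate ⊢
  have ha1 : 1 < a := by linarith
  have hη : 0 < η := by
    refine lt_of_le_of_ne hη0 fun h => ?_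
    rw [← h] at hrate
    rw [sub_zero, div_self (by linarith)] at hrate
    simp at hrate
    linarith
  obtain ⟨p, hp⟩ : ∃ p, p = (a - η) / a := ⟨_, rfl⟩
  have hp0 : 0 < p := by rw [hp]; exact div_pos ht (by linarith)
  have hpa : (1 - p) * a = η := by rw [hp]; field_simp; ring
  have hp1 : p < 1 := by nlinarith
  rw [← hp] at hrate
  -- The slope in `ξ` is above -1, so going `p / 2` beyond `ξ = 2` costs at most half of the surplus
  -- `p`.
  refine ⟨p, 2 + min (p / 2) (θ₁ - 2), 1 + min (2 * (1 - p)) (p / 2), hp0, hp1.le,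
    ?_, ?_, ?_, ?_⟩
  · have : 0 < min (p / 2) (θ₁ - 2) := lt_min (by linarith) (by linarith)
    linarith
  · linarith [min_le_right (p / 2) (θ₁ - 2)]
  · have : 0 < min (2 * (1 - p)) (p / 2) := lt_min (by linarith) (by linarith)
    linarith
  · intro ξ hξ0 hξD
    have h3 := min_le_left (p / 2) (θ₁ - 2)
    have h3' : 0 < min (p / 2) (θ₁ - 2) := lt_min (by linarith) (by linarith)
    have hm1 := min_le_left (2 * (1 - p)) (p / 2)
    have hm2 := min_le_right (2 * (1 - p)) (p / 2)
    have key : 1 + 2 * (1 - p) + ξ * (3 / 2 * p - 1) ≤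
        (ξ + (1 - p) * (2 * θ₁ + 2 * θ₂ - 3 * ξ)) / 2 + (a - η) * Real.log p := by
      have h5 : θ₁ + θ₂ = a + 2 := by linarith
      nlinarith
    refine le_trans ?_ key
    by_cases hc : 0 ≤ 3 / 2 * p - 1
    · nlinarith [mul_nonneg hξ0 hc]
    · have h6 := mul_le_mul_of_nonpos_right hξD (not_le.1 hc).le
      nlinarith

end Constants

/-! ### Limits as `n → ∞` and the two regimes -/

section Asymptotics

open Filter Topology

theorem tendsto_log_natCast : Tendsto (fun n : ℕ => Real.log n) atTop atTop :=
  Real.tendsto_log_atTop.comp tendsto_natCast_atTop_atTop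

theorem tendsto_log_div_natCast : Tendsto (fun n : ℕ => Real.log n / n) atTop (𝓝 0) :=
  (Real.isLittleO_log_id_atTop.tendsto_div_nhds_zero).comp tendsto_natCast_atTop_atTop

theorem tendsto_gap_bound {D : ℝ} (hD : 2 < D) :
    Tendsto (fun n : ℕ => n * Real.exp (-((n / 2 - 1) * (D * (Real.log n / n))))) atTop (𝓝 0) := by
  have h1 : Tendsto (fun n : ℕ => Real.exp (-((D / 2 - 1) * Real.log n)) *
      Real.exp (D * (Real.log n / n))) atTop (𝓝 (0 * Real.exp (D * 0))) :=
    (Real.tendsto_exp_neg_atTop_nhds_zero.comp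
      (tendsto_log_natCast.const_mul_atTop (by linarith))).mul
      ((Real.continuous_exp.tendsto _).comp (tendsto_log_div_natCast.const_mul D))
  rw [zero_mul] at h1
  refine h1.congr' ?_
  filter_upwards [eventually_gt_atTop 0] with n hn
  have hn' : (0 : ℝ) < n := by exact_mod_cast hn
  conv_rhs => enter [1]; rw [← Real.exp_log hn']
  rw [← Real.exp_add, ← Real.exp_add]
  congr 1
  field_simp
  ring

theorem tendsto_pair_bound {κ a b : ℝ} (hκ : 1 < κ) :
    Tendsto (fun n : ℕ => n * n * (Real.exp (a * (Real.log n / n) - κ * Real.log n) *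
      (b * (Real.log n / n)))) atTop (𝓝 0) := by
  have h0 : Tendsto (fun x : ℝ => x * Real.exp (-((κ - 1) * x))) atTop (𝓝 0) := by
    have := Real.tendsto_pow_mul_exp_neg_atTop_nhds_zero 1
    have h := (this.comp (tendsto_id.const_mul_atTop (show 0 < κ - 1 by linarith))).const_mul
      (1 / (κ - 1))
    rw [mul_zero] at h
    refine h.congr fun x => ?_
    have : κ - 1 ≠ 0 := by linarith
    simp only [Function.comp_apply, id]
    field_simp
  have h1 : Tendsto (fun n : ℕ => b * (Real.log n * Real.exp (-((κ - 1) * Real.log n))) *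
      Real.exp (a * (Real.log n / n))) atTop (𝓝 (b * 0 * Real.exp (a * 0))) :=
    ((h0.comp tendsto_log_natCast).const_mul b).mul
      ((Real.continuous_exp.tendsto _).comp (tendsto_log_div_natCast.const_mul a))
  rw [mul_zero, zero_mul] at h1
  refine h1.congr' ?_
  filter_upwards [eventually_gt_atTop 0] with n hn
  have hn' : (0 : ℝ) < n := by exact_mod_cast hn
  have h2 : Real.exp (a * (Real.log n / n) - κ * Real.log n) =
      Real.exp (a * (Real.log n / n)) * Real.exp (-((κ - 1) * Real.log n)) / n := by
    conv_rhs => enter [2]; rw [← Real.exp_log hn']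
    rw [← Real.exp_add, ← Real.exp_sub]
    congr 1
    ring
  rw [h2]
  field_simp

theorem natCast_mul_threshold {θ₁ θ₂ : ℝ} {n : ℕ} (hn : 0 < n) :
    n * threshold θ₁ θ₂ n = (θ₁ + θ₂ - 2 - eta θ₁ θ₂) * Real.log n := by
  have hn' : (0 : ℝ) < n := by exact_mod_cast hn
  unfold threshold
  field_simp

theorem eventually_measure_not_reachable_le {θ₁ θ₂ : ℝ} (h₁ : 2 < θ₁) (h₂ : 1 ≤ θ₂)
    (ht : 0 < θ₁ + θ₂ - 2 - eta θ₁ θ₂) {δ : ℝ} (hδ : 0 < δ) :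
    ∀ᶠ n : ℕ in atTop, ∀ σ : Fin n → Fin 2, IsBalanced σ →
      featureMeasure n {X | ¬ ∀ u v, σ u = σ v →
        (sameGraph (phaseOne (graph σ θ₁ θ₂ X) (threshold θ₁ θ₂ n)) σ).Reachable u v} ≤
      ENNReal.ofReal δ := by
  obtain ⟨p, D, κ, hp0, hp1, hD2, hD, hκ1, hκ⟩ := exists_gap_exponent h₁ h₂ ht
  have hlim := (tendsto_gap_bound hD2).add
    (tendsto_pair_bound (a := 2 * (D + 2 * θ₁)) (b := 2 * D) hκ1)
  rw [add_zero] at hlim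
  have hr : ∀ θ : ℝ, ∀ᶠ n : ℕ in atTop, θ * (Real.log n / n) ≤ 1 / 2 := by
    intro θ
    have := tendsto_log_div_natCast.const_mul θ
    rw [mul_zero] at this
    exact this.eventually_le_const (by norm_num)
  filter_upwards [eventually_gt_atTop 0, hlim.eventually_le_const hδ, hr θ₁, hr θ₂]
    with n hn hle hr₁ hr₂ σ hσ
  refine (measure_not_reachable_le hσ hn hp0 hp1 (by linarith) hD hr₁ hr₂ hκ
    (natCast_mul_threshold hn)).trans (ENNReal.ofReal_le_ofReal (le_trans (le_of_eq ?_) hle))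
  rw [show 2 * (Real.log n / n) * (D + 2 * θ₁) = 2 * (D + 2 * θ₁) * (Real.log n / n) by ring]
  ring

/-- Without edges between the communities, Phase 1 recovers them. -/
theorem phaseOne_recovers {θ₁ θ₂ : ℝ} (h₁ : 2 < θ₁) (h₂ : 1 ≤ θ₂)
    (ht : tOne θ₂ < θ₁ - θ₂ - 2 - eta θ₁ θ₂) {δ : ℝ} (hδ : 0 < δ) :
    ∀ᶠ n : ℕ in atTop, ∀ σ : Fin n → Fin 2, IsBalanced σ →
      ENNReal.ofReal (1 - δ) ≤ featureMeasure n
        {X | Recovers (phaseOne (graph σ θ₁ θ₂ X) (threshold θ₁ θ₂ n)) σ} := by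
  obtain ⟨s, hs0, hs⟩ := exists_lt_of_tOne_lt h₂ ht
  have ht0 := tOne_nonneg (θ₂ := θ₂)
  have hlim := tendsto_pair_bound (a := 0) (b := 2 * θ₂) hs
  filter_upwards [eventually_gt_atTop 0, hlim.eventually_le_const (half_pos hδ),
    eventually_measure_not_reachable_le h₁ h₂ (by linarith) (half_pos hδ)] with n hn hle hreach σ hσ
  have h3 := hreach σ hσ
  -- Level `K = 1` suffices: an integer count below 1 is 0.
  have h4 := (measure_crossPairs_le (σ := σ) (θ₁ := θ₁) hn (by linarith : 0 ≤ θ₂) hs0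
    (natCast_mul_threshold (θ₁ := θ₁) (θ₂ := θ₂) hn) one_pos).trans
    (ENNReal.ofReal_le_ofReal (le_trans (le_of_eq ?_) hle))
  · refine le_measure_of_compl_subset _ hδ.le ((measure_union_le _ _).trans
      ((add_le_add h3 h4).trans ?_)) ?_
    · rw [← ENNReal.ofReal_add (by linarith) (by linarith), add_halves]
    · intro X hX
      simp only [Set.mem_union, Set.mem_ofPred_eq, not_or, not_not, Nat.one_le_cast] at hX
      obtain ⟨h5, h6⟩ := hX
      refine recovers_of_not_preconnected (hσ.surjective hn)
        (fun u v huv => (h5 u v huv).mono fun a b (hab : (sameGraph _ σ).Adj a b) => hab.1)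
        (not_preconnected_of_no_cross (hσ.surjective hn) fun u v huv => ?_)
      by_contra hne
      have h7 : crossPairs (phaseOne (graph σ θ₁ θ₂ X) (threshold θ₁ θ₂ n)) σ = ∅ := by
        rw [← Set.ncard_eq_zero (Set.toFinite _)]
        omega
      exact (h7 ▸ show (u, v) ∈ crossPairs _ σ from ⟨huv, hne⟩ : (u, v) ∈ (∅ : Set (Fin n × Fin n)))
  · rw [div_one, mul_comm (2 * (θ₂ * _))]
    congr 2
    · congr 1
      ring
    · ring

theorem clog_le {n : ℕ} (hn : 1 < n) : (Nat.clog 2 n : ℝ) ≤ 2 * Real.log n + 1 := by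
  have h1 := Nat.pow_pred_clog_lt_self one_lt_two hn
  have h2 : ((2 : ℝ) ^ (Nat.clog 2 n).pred) ≤ n := by exact_mod_cast h1.le
  have h3 := Real.log_le_log (by positivity) h2
  rw [Real.log_pow] at h3
  have h4 : (Nat.clog 2 n : ℝ) ≤ (Nat.clog 2 n).pred + 1 := by
    exact_mod_cast (Nat.succ_pred_eq_of_pos (Nat.clog_pos one_lt_two hn)).ge
  have h5 := Real.log_two_gt_d9
  have h6 : (0 : ℝ) ≤ (Nat.clog 2 n).pred := Nat.cast_nonneg _
  nlinarith

theorem exp_neg_mul_log_eq_rpow {n : ℕ} (hn : 0 < n) (x : ℝ) :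
    Real.exp (-x * Real.log n) = (n : ℝ) ^ (1 - x) / n := by
  have hn' : (0 : ℝ) < n := by exact_mod_cast hn
  rw [Real.rpow_sub hn', Real.rpow_one, Real.rpow_def_of_pos hn', mul_comm (Real.log n) x,
    neg_mul, Real.exp_neg]
  field_simp

/-- `S²` recovers the communities with few queries. -/
theorem s2_phaseOne_recovers {θ₁ θ₂ : ℝ} (h₁ : 2 < θ₁) (h₂ : 1 ≤ θ₂)
    (ht : 0 < θ₁ - θ₂ - 2 - eta θ₁ θ₂) (ht' : θ₁ - θ₂ - 2 - eta θ₁ θ₂ < tOne θ₂)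
    {δ : ℝ} (hδ : 0 < δ) :
    ∀ᶠ n : ℕ in atTop, ∀ σ : Fin n → Fin 2, IsBalanced σ →
      ∀ rule : SimpleGraph (Fin n) → List (Fin n × Fin 2) → Option (Fin n), IsMSSPRule rule →
      ∀ budget : ℕ, 5 * queryRate θ₁ θ₂ n ≤ budget →
        ENNReal.ofReal (1 - δ) ≤
          ∫⁻ X, (s2 rule (phaseOne (graph σ θ₁ θ₂ X) (threshold θ₁ θ₂ n)) σ
            budget []).toOuterMeasure
            {L | Recovers (cutGraph (phaseOne (graph σ θ₁ θ₂ X) (threshold θ₁ θ₂ n)) L) σ ∧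
              (L.length : ℝ) ≤ 5 * queryRate θ₁ θ₂ n} ∂featureMeasure n := by
  have hm : θ₁ + θ₂ - 2 - eta θ₁ θ₂ = 2 * θ₂ + (θ₁ - θ₂ - 2 - eta θ₁ θ₂) := by ring
  have hs1 : 1 ≤ (θ₁ + θ₂ - 2 - eta θ₁ θ₂) / (2 * θ₂) := by
    rw [le_div_iff₀ (by linarith)]
    linarith
  -- The maximizer of `s m - 2θ₂(e^s - 1)`, at which the exponent equals `ε`.
  set s := Real.log ((θ₁ + θ₂ - 2 - eta θ₁ θ₂) / (2 * θ₂)) with hs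
  have hs0 : 0 ≤ s := Real.log_nonneg hs1
  have hε : s * (θ₁ + θ₂ - 2 - eta θ₁ θ₂) - 2 * θ₂ * (Real.exp s - 1) = epsilon θ₁ θ₂ := by
    rw [hs, Real.exp_log (by linarith), epsilon]
    have : θ₂ ≠ 0 := by linarith
    field_simp
    ring
  -- Being below `t₁` gives `n ^ (1 - ε) ≥ 1`, which later absorbs additive constants.
  have hε1 : epsilon θ₁ θ₂ ≤ 1 := by
    have := rate_le_one_of_lt_tOne ht.le ht'
    rwa [← hm] at this
  have hlim1 : Tendsto (fun n : ℕ => 2 * θ₂ / Real.log n) atTop (𝓝 0) :=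
    tendsto_log_natCast.const_div_atTop _
  have hlim2 : Tendsto (fun n : ℕ => (1 / 2 : ℝ) ^ ⌊Real.log n⌋₊) atTop (𝓝 0) :=
    (tendsto_pow_atTop_nhds_zero_of_lt_one (by norm_num) (by norm_num)).comp
      (tendsto_nat_floor_atTop.comp tendsto_log_natCast)
  have hδ3 : 0 < δ / 3 := by linarith
  filter_upwards [eventually_gt_atTop 1, hlim1.eventually_le_const hδ3,
    hlim2.eventually_le_const hδ3, tendsto_log_natCast.eventually_ge_atTop 1,
    eventually_measure_not_reachable_le h₁ h₂ (by linarith) hδ3]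
    with n hn1 hle hj hlog hreach σ hσ rule hrule budget hbudget
  have hn : 0 < n := by omega
  have hn' : (0 : ℝ) < n := by exact_mod_cast hn
  set ℓ := Real.log n with hℓ
  set M := (n : ℝ) ^ (1 - epsilon θ₁ θ₂) with hM
  have hM1 : 1 ≤ M := Real.one_le_rpow (by exact_mod_cast hn) (by linarith)
  have hrate : queryRate θ₁ θ₂ n = M * ℓ ^ 3 + ℓ := rfl
  -- The expected number of cross pairs is `O(M ℓ)`; the additional factor `ℓ` makes the Markov
  -- bound `2θ₂ / ℓ` tend to 0.
  have hK : 0 < M * ℓ ^ 2 := by positivity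
  have h3 := hreach σ hσ
  have h4 := (measure_crossPairs_le (σ := σ) (θ₁ := θ₁) hn (by linarith : 0 ≤ θ₂) hs0
    (natCast_mul_threshold (θ₁ := θ₁) (θ₂ := θ₂) hn) hK).trans
    (ENNReal.ofReal_le_ofReal (le_trans (le_of_eq ?_) hle))
  swap
  · rw [hε, exp_neg_mul_log_eq_rpow hn, ← hM, ← hℓ]
    have : M ≠ 0 := by linarith
    have : ℓ ≠ 0 := by linarith
    field_simp
  have hbad := (measure_union_le _ _).trans (add_le_add h3 h4)
  rw [← ENNReal.ofReal_add hδ3.le hδ3.le] at hbad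
  rw [show δ = δ / 3 + (δ / 3 + δ / 3) by ring]
  refine le_lintegral_of_measure_le _ hδ3.le (by linarith) hbad fun X hX => ?_
  simp only [Set.mem_union, Set.mem_ofPred_eq, not_or, not_not, not_le] at hX
  obtain ⟨h5, h6⟩ := hX
  have hrate0 : 0 ≤ 5 * queryRate θ₁ θ₂ n := by rw [hrate]; positivity
  have he := Nat.le_floor h6.le
  have hfloor := Nat.floor_le hrate0
  have hrun := s2_recovers hrule hσ hn h5 (Nat.le_pow_clog one_lt_two n) he ⌊ℓ⌋₊ budget
    ⌊5 * queryRate θ₁ θ₂ n⌋₊ ?_ ?_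
  · refine le_trans ?_ (hrun.trans (measure_mono fun L hL =>
      ⟨hL.1, le_trans (by exact_mod_cast hL.2) hfloor⟩))
    have hpow : (1 / 2 : ENNReal) ^ ⌊ℓ⌋₊ = ENNReal.ofReal ((1 / 2) ^ ⌊ℓ⌋₊) := by
      rw [ENNReal.ofReal_pow (by norm_num), ENNReal.ofReal_div_of_pos two_pos]
      simp
    rw [hpow, ENNReal.ofReal_sub _ hδ3.le, ENNReal.ofReal_one]
    gcongr
  · refine Nat.le_floor ?_
    push_cast
    have hB := clog_le hn1
    have h7 := Nat.floor_le (show 0 ≤ ℓ by linarith)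
    have h8 := Nat.floor_le hK.le
    -- Bisection costs at most `4 M ℓ³`; the remaining `1 + j + B ≤ 3 ℓ + 2` fits into `M ℓ³ + 5 ℓ`,
    -- which gives the constant 5.
    have h9 : (⌊M * ℓ ^ 2⌋₊ : ℝ) * (Nat.clog 2 n + 1) ≤ M * ℓ ^ 2 * (4 * ℓ) := by
      gcongr
      linarith
    have h10 : 1 ≤ M * ℓ ^ 3 := one_le_mul_of_one_le_of_one_le hM1 (one_le_pow₀ hlog)
    rw [hrate]
    nlinarith
  · exact_mod_cast hfloor.trans hbudget

end Asymptotics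

end GBM

theorem theorem1 (θ₁ θ₂ : ℝ) (h₁ : 2 * θ₂ < θ₁) (h₂ : 2 ≤ 2 * θ₂) :
    (GBM.tOne θ₂ < θ₁ - θ₂ - 2 - GBM.eta θ₁ θ₂ →
      ∀ δ : ℝ, 0 < δ → ∃ N : ℕ, ∀ n : ℕ, N ≤ n →
        ∀ σ : Fin n → Fin 2, GBM.IsBalanced σ →
          ENNReal.ofReal (1 - δ) ≤
            GBM.featureMeasure n
              {X | GBM.Recovers
                (GBM.phaseOne (GBM.graph σ θ₁ θ₂ X) (GBM.threshold θ₁ θ₂ n)) σ}) ∧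
    (0 < θ₁ - θ₂ - 2 - GBM.eta θ₁ θ₂ → θ₁ - θ₂ - 2 - GBM.eta θ₁ θ₂ < GBM.tOne θ₂ →
      ∃ C : ℝ, 0 < C ∧
        ∀ δ : ℝ, 0 < δ → ∃ N : ℕ, ∀ n : ℕ, N ≤ n →
          ∀ σ : Fin n → Fin 2, GBM.IsBalanced σ →
          ∀ rule : SimpleGraph (Fin n) → List (Fin n × Fin 2) → Option (Fin n),
            GBM.IsMSSPRule rule →
          ∀ budget : ℕ, C * GBM.queryRate θ₁ θ₂ n ≤ budget →
            ENNReal.ofReal (1 - δ) ≤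
              ∫⁻ X, (GBM.s2 rule
                  (GBM.phaseOne (GBM.graph σ θ₁ θ₂ X) (GBM.threshold θ₁ θ₂ n)) σ
                  budget []).toOuterMeasure
                {L | GBM.Recovers
                    (GBM.cutGraph
                      (GBM.phaseOne (GBM.graph σ θ₁ θ₂ X) (GBM.threshold θ₁ θ₂ n)) L) σ ∧
                  (L.length : ℝ) ≤ C * GBM.queryRate θ₁ θ₂ n}
                ∂(GBM.featureMeasure n)) := by
  have h₂' : 1 ≤ θ₂ := by linarith
  have h₁' : 2 < θ₁ := by linarith
  refine ⟨fun ht δ hδ => ?_, fun ht ht' => ⟨5, by norm_num, fun δ hδ => ?_⟩⟩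
  · exact Filter.eventually_atTop.1 (GBM.phaseOne_recovers h₁' h₂' ht hδ)
  · exact Filter.eventually_atTop.1 (GBM.s2_phaseOne_recovers h₁' h₂' ht ht' hδ)
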